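/- Let $b:[0,1]\times\mathbb R^d\to\mathbb R^d$ and $r:\mathbb R^d\to\mathbb R$, and let $M,K,G,L_r>0$. Assume that $s\mapsto b_s(x)$ is continuous on $[0,1]$ for every $x$, that each $b_s$ and $r$ are differentiable, and that for all $s\in[0,1]$ and $z,z'\in\mathbb R^d$ $$\|\nabla b_s(z)\|_{\mathrm{op}}\le M,\quad \|\nabla b_s(z)-\nabla b_s(z')\|_{\mathrm{op}}\le K\|z-z'\|,\quad \|\nabla r(z)\|\le G,\quad \|\nabla r(z)-\nabla r(z')\|\le L_r\|z-z'\|.$$ For $s\le t$ let $X_{s,t}$ be the flow map of $\dot x_t=b_t(x_t)$, that is, $X_{s,t}(x)=x+\int_s^t b_\tau(X_{s,\tau}(x))\,d\tau$. For $\lambda>0$ and $t\in[0,1]$ let $$V^\lambda_t(x)=\inf_{u\in L^2([t,1];\mathbb R^d)}\Big\{\int_t^1\frac{\|u_\tau\|^2}{2\lambda}\,d\tau-r(x^u_1)\Big\},\qquad x^u_\tau=x+\int_t^\tau\big(b_s(x^u_s)+u_s\big)\,ds,$$ and write $u^*_t(x)=-\lambda\nabla V^\lambda_t(x)$ for the optimal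 feedback and $u^J_t(x)=\lambda\,\nabla X_{t,1}(x)^{\mathsf T}\nabla r(X_{t,1}(x))$ for the greedy guidance. Suppose that there are functions $V^0_t,V^1_t:\mathbb R^d\to\mathbb R$ such that, for each $t\in[0,1]$, $V^\lambda_t(x)=V^0_t(x)+\lambda V^1_t(x)+O(\lambda^2)$ as $\lambda\downarrow0$, uniformly in $x\in\mathbb R^d$. Then: (i) For all $t\in[0,1]$ and $x\in\mathbb R^d$, $V^0_t(x)=-r(X_{t,1}(x))$; the maps $X_{t,1}$ and $V^0_t$ are differentiable, and $u^J_t(x)=-\lambda\nabla V^0_t(x)$ for all $\lambda>0$. (ii) There are $C_2\in\mathbb R$ and $\lambda_0>0$ such that for all $\lambda\in(0,\lambda_0)$: $V^\lambda_t$ is differentiable on $\mathbb R^d$ for all $t\in[0,1]$; $u^*$ is an optimal feedback, i.e. from every $(t,x)$ the closed-loop dynamics $\dot x_\tau=b_\tau(x_\tau)+u^*_\tau(x_\tau)$ has a solution on $[t,1]$ along which the control $u^*_\tau(x_\tau)$ is in $L^2$ and attains the infimum $V^\lambda_t(x)$; and $$\|u^*_t(x)-u^J_t(x)\|\le C_1\lambda^2+C_2\lambda^3\qquad\text{for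 all }t\in[0,1],\ x\in\mathbb R^d,$$ where $C_1$ depends only on $M,K,G,L_r$ and is given by $$C_1=\int_0^1 e^{M\tau}\,\Big[\tfrac{KG}{M}\big(e^{2M(1-\tau)}-e^{M(1-\tau)}\big)+L_r\,e^{2M(1-\tau)}\Big]\,e^{M(1-\tau)}G\,d\tau .$$ -/

import Mathlib

/-- The state space `ℝ^d` with its Euclidean norm. -/
abbrev State (d : ℕ) : Type := EuclideanSpace ℝ (Fin d)

/-- Regularity of the drift `b` (for times in `[0, 1]`) and of the reward `r` on `ℝ^d`: bounded and
Lipschitz spatial derivatives with constants `M, K` (drift) and `G, L` (reward), the drift being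
continuous in time. -/
structure RegularityBounds {d : ℕ} (b : ℝ → State d → State d) (r : State d → ℝ)
    (M K G L : ℝ) : Prop where
  M_pos : 0 < M
  K_pos : 0 < K
  G_pos : 0 < G
  L_pos : 0 < L
  drift_time_continuous : ∀ x, ContinuousOn (fun s => b s x) (Set.Icc 0 1)
  drift_differentiable : ∀ s ∈ Set.Icc (0 : ℝ) 1, Differentiable ℝ (b s)
  drift_jacobian_bound : ∀ s ∈ Set.Icc (0 : ℝ) 1, ∀ z, ‖fderiv ℝ (b s) z‖ ≤ M
  drift_jacobian_lipschitz : ∀ s ∈ Set.Icc (0 : ℝ) 1, ∀ z z',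
    ‖fderiv ℝ (b s) z - fderiv ℝ (b s) z'‖ ≤ K * ‖z - z'‖
  reward_differentiable : Differentiable ℝ r
  reward_gradient_bound : ∀ z, ‖gradient r z‖ ≤ G
  reward_gradient_lipschitz : ∀ z z', ‖gradient r z - gradient r z'‖ ≤ L * ‖z - z'‖

/-- `γ` solves `γ' = b_τ(γ) + u_τ` on `[t, 1]` with `γ t = x`, in the integral (Carathéodory)
sense that is needed for square-integrable controls. -/
structure IsControlledTrajectory {d : ℕ} (b : ℝ → State d → State d) (u : ℝ → State d)
    (t : ℝ) (x : State d) (γ : ℝ → State d) : Prop where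
  continuousOn : ContinuousOn γ (Set.Icc t 1)
  integrable : IntervalIntegrable (fun s => b s (γ s) + u s) MeasureTheory.volume t 1
  eq_integral : ∀ τ ∈ Set.Icc t 1, γ τ = x + ∫ s in t..τ, (b s (γ s) + u s)

open Classical in
/-- The uncontrolled flow map `X_{s,t}(x)`, for `s ≤ t ≤ 1`: the value at time `t` of the solution
of `γ' = b_τ(γ)` with `γ s = x` (with the value `x` if there were no solution). -/
noncomputable def flowMap {d : ℕ} (b : ℝ → State d → State d) (s t : ℝ) (x : State d) : State d :=
  if h : ∃ γ, IsControlledTrajectory b (fun _ => 0) s x γ then h.choose t else x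

/-- `(u, γ)` is admissible from `(t, x)`: `u ∈ L²([t, 1]; ℝ^d)` and `γ` is a trajectory driven
by `u`. -/
def IsAdmissible {d : ℕ} (b : ℝ → State d → State d) (t : ℝ) (x : State d)
    (u γ : ℝ → State d) : Prop :=
  MeasureTheory.MemLp u 2 (MeasureTheory.volume.restrict (Set.Icc t 1)) ∧
    IsControlledTrajectory b u t x γ

/-- The cost `∫_t^1 ‖u_τ‖² / (2λ) dτ - r(γ_1)` of a control and its trajectory. -/
noncomputable def controlCost {d : ℕ} (r : State d → ℝ) (lam t : ℝ) (u γ : ℝ → State d) : ℝ :=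
  (∫ τ in t..1, 1 / (2 * lam) * ‖u τ‖ ^ 2) - r (γ 1)

/-- The value function `V_t^λ(x)`, the infimum of the cost over all admissible pairs. -/
noncomputable def valueFunction {d : ℕ} (b : ℝ → State d → State d) (r : State d → ℝ)
    (lam t : ℝ) (x : State d) : ℝ :=
  sInf {c : ℝ | ∃ u γ : ℝ → State d, IsAdmissible b t x u γ ∧ c = controlCost r lam t u γ}

/-- `V_t^λ(x) = V_t^0(x) + λ V_t^1(x) + O(λ²)` as `λ ↓ 0`, uniformly in `x`, for all times `t`. -/
def HasUniformExpansion {d : ℕ} (b : ℝ → State d → State d) (r : State d → ℝ)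
    (V0 V1 : ℝ → State d → ℝ) : Prop :=
  ∀ t ∈ Set.Icc (0 : ℝ) 1, ∃ C : ℝ, ∃ lam₀ > 0, ∀ lam ∈ Set.Ioo (0 : ℝ) lam₀, ∀ x : State d,
    |valueFunction b r lam t x - (V0 t x + lam * V1 t x)| ≤ C * lam ^ 2

/-- The greedy guidance `u^J_t(x) = λ ∇X_{t,1}(x)ᵀ ∇r(X_{t,1}(x))`. -/
noncomputable def greedyGuidance {d : ℕ} (b : ℝ → State d → State d) (r : State d → ℝ)
    (lam t : ℝ) (x : State d) : State d :=
  lam • (ContinuousLinearMap.adjoint (fderiv ℝ (flowMap b t 1) x)) (gradient r (flowMap b t 1 x))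

/-- The feedback `u*_t(x) = -λ ∇V_t^λ(x)`. -/
noncomputable def optimalFeedback {d : ℕ} (b : ℝ → State d → State d) (r : State d → ℝ)
    (lam t : ℝ) (x : State d) : State d :=
  -(lam • gradient (valueFunction b r lam t) x)

/-- The feedback law `φ` is optimal: from every `(t, x)` the closed-loop dynamics
`γ' = b_τ(γ) + φ_τ(γ)` has a solution for which the control `τ ↦ φ_τ(γ_τ)` is admissible and
minimizes the cost. -/
def IsOptimalFeedbackLaw {d : ℕ} (b : ℝ → State d → State d) (r : State d → ℝ) (lam : ℝ)
    (φ : ℝ → State d → State d) : Prop :=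
  ∀ t ∈ Set.Icc (0 : ℝ) 1, ∀ x : State d, ∃ γ : ℝ → State d,
    IsAdmissible b t x (fun τ => φ τ (γ τ)) γ ∧
    ∀ v η : ℝ → State d, IsAdmissible b t x v η →
      controlCost r lam t (fun τ => φ τ (γ τ)) γ ≤ controlCost r lam t v η

/-- Grönwall bound on the Jacobian of the flow map over a time span `h`. -/
noncomputable def jacobianBound (M h : ℝ) : ℝ := Real.exp (M * h)

/-- Grönwall bound on the Hessian of the flow map over a time span `h`. -/
noncomputable def hessianBound (M K h : ℝ) : ℝ :=
  K / M * (Real.exp (2 * M * h) - Real.exp (M * h))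

/-- The constant `C₁(M, K, G, L)`, built from the Jacobian and Hessian bounds. -/
noncomputable def feedbackConstant (M K G L : ℝ) : ℝ :=
  ∫ τ in (0 : ℝ)..1, jacobianBound M τ *
    (hessianBound M K (1 - τ) * G + jacobianBound M (1 - τ) ^ 2 * L) *
    (jacobianBound M (1 - τ) * G)

/-! The proof is a quantitative Pontryagin principle. For small `lam` every `(t, x)` starts a
solution `(γ, p)` of the Hamiltonian system: state driven by `lam • p`, costate `p' = -∇b(γ)ᵀp`, and
`p 1 = ∇r(γ 1)` (`exists_extremal`).

Testing the difference of two trajectories against the costate gives a first-order expansion of the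
terminal reward with an explicit quadratic remainder (`reward_expansion`). The control cost has
curvature `1/lam`, which dominates this remainder when `lam` is small. Extremals are therefore
global minimizers (`extremal_cost_le`), and the same inequality with a varying initial value yields
`∇V^λ_t(x) = -p t` (`hasGradientAt_valueFunction`). Hence `u* = lam • p t`.

The greedy guidance is `lam • q t`, with `q` the costate along the uncontrolled trajectory
(`adjoint_fderiv_flowMap`). So it remains to compare two costates. Grönwall for the states and then
for the costates, both with exact solutions of the comparison equations, gives `‖p t - q t‖ ≤ C₁
lam` (`extremal_costate_sub_bound`), where `C₁` is the stated integral in closed form. The error is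
thus at most `C₁ lam²`, without a cubic term.

For part (i), the zero control and Young's inequality give `V^λ = -r ∘ X_{t,1} + O(lam)`, so letting
`lam ↓ 0` in the expansion identifies `V⁰`. -/

open Set MeasureTheory Filter Topology

/-! ### Grönwall inequalities. -/

section Gronwall

variable {E : Type*} [NormedAddCommGroup E] [NormedSpace ℝ E]

/-- Grönwall's inequality with a supersolution `B` of the comparison equation `B' = M B + g`. -/
theorem norm_le_supersolution {f f' : ℝ → E} {B B' g : ℝ → ℝ} {M a b : ℝ}
    (hf : ∀ x ∈ Icc a b, HasDerivWithinAt f (f' x) (Icc a b) x)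
    (ha : ‖f a‖ ≤ B a) (hB : ∀ x, HasDerivAt B (B' x) x)
    (bound : ∀ x ∈ Icc a b, ‖f' x‖ ≤ M * ‖f x‖ + g x)
    (hBg : ∀ x ∈ Icc a b, M * B x + g x ≤ B' x) :
    ∀ x ∈ Icc a b, ‖f x‖ ≤ B x := by
  -- The comparison principle needs a strict differential inequality where the norm touches the
  -- barrier. The perturbation grows at rate `M + 1 > M`, which provides it; afterwards `ε → 0`.
  have key : ∀ ε > 0, ∀ x ∈ Icc a b, ‖f x‖ ≤ B x + ε * Real.exp ((M + 1) * x) := by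
    intro ε hε
    refine image_norm_le_of_norm_deriv_right_lt_deriv_boundary
      (f' := f') (B' := fun x => B' x + ε * (Real.exp ((M + 1) * x) * ((M + 1) * 1)))
      (fun x hx => (hf x hx).continuousWithinAt) (fun x hx => ?_) ?_ (fun x => ?_) (fun x hx h => ?_)
    · exact (hf x (Ico_subset_Icc_self hx)).mono_of_mem_nhdsWithin
        (mem_of_superset (Icc_mem_nhdsGE hx.2) (Icc_subset_Icc_left hx.1))
    · have := Real.exp_pos ((M + 1) * a)
      nlinarith
    · exact (hB x).add ((((hasDerivAt_id x).const_mul (M + 1)).exp).const_mul ε)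
    · have h1 := bound x (Ico_subset_Icc_self hx)
      have h2 := hBg x (Ico_subset_Icc_self hx)
      have h3 : 0 < ε * Real.exp ((M + 1) * x) := by positivity
      rw [h] at h1
      nlinarith
  intro x hx
  refine le_of_forall_pos_le_add fun ε hε => ?_
  have := key (ε / Real.exp ((M + 1) * x)) (by positivity) x hx
  rwa [div_mul_cancel₀ _ (Real.exp_pos _).ne'] at this

theorem hasDerivWithinAt_comp_reverse {f : ℝ → E} {f' : E} {a b x : ℝ}
    (hf : HasDerivWithinAt f f' (Icc a b) (a + b - x)) :
    HasDerivWithinAt (fun s => f (a + b - s)) (-f') (Icc a b) x := by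
  have hm : MapsTo (fun s => a + b - s) (Icc a b) (Icc a b) := fun s hs =>
    ⟨by linarith [hs.2], by linarith [hs.1]⟩
  have h := HasDerivWithinAt.scomp x hf ((hasDerivWithinAt_id x (Icc a b)).const_sub (a + b)) hm
  simpa [Function.comp_def] using h

theorem reverse_mem_Icc {a b x : ℝ} (hx : x ∈ Icc a b) : a + b - x ∈ Icc a b :=
  ⟨by linarith [hx.2], by linarith [hx.1]⟩

/-- Grönwall's inequality backwards in time. -/
theorem norm_le_supersolution_backward {f f' : ℝ → E} {B B' g : ℝ → ℝ} {M a b : ℝ}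
    (hf : ∀ x ∈ Icc a b, HasDerivWithinAt f (f' x) (Icc a b) x)
    (hb : ‖f b‖ ≤ B b) (hB : ∀ x, HasDerivAt B (B' x) x)
    (bound : ∀ x ∈ Icc a b, ‖f' x‖ ≤ M * ‖f x‖ + g x)
    (hBg : ∀ x ∈ Icc a b, M * B x + g x ≤ -B' x) :
    ∀ x ∈ Icc a b, ‖f x‖ ≤ B x := by
  intro x hx
  have h := norm_le_supersolution (f := fun s => f (a + b - s)) (f' := fun s => -f' (a + b - s))
    (B := fun s => B (a + b - s)) (B' := fun s => -B' (a + b - s)) (g := fun s => g (a + b - s))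
    (M := M) (a := a) (b := b)
    (fun s hs => hasDerivWithinAt_comp_reverse (hf _ (reverse_mem_Icc hs)))
    (by simpa using hb)
    (fun s => (hB (a + b - s)).comp_const_sub (a + b) s)
    (fun s hs => by simpa using bound _ (reverse_mem_Icc hs))
    (fun s hs => hBg _ (reverse_mem_Icc hs)) (a + b - x) (reverse_mem_Icc hx)
  simpa using h

/-- Grönwall's inequality in integral form. -/
theorem le_mul_exp_of_le_add_integral {φ : ℝ → ℝ} {a b D M : ℝ} (hM : 0 ≤ M)
    (hφ : ContinuousOn φ (Icc a b))
    (h : ∀ τ ∈ Icc a b, φ τ ≤ D + M * ∫ s in a..τ, φ s) :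
    ∀ τ ∈ Icc a b, φ τ ≤ D * Real.exp (M * (τ - a)) := by
  intro τ hτ
  have hab : a ≤ b := hτ.1.trans hτ.2
  have hF : ∀ x ∈ Icc a b, HasDerivWithinAt (fun τ => D + M * ∫ s in a..τ, φ s) (M * φ x)
      (Icc a b) x := by
    intro x hx
    have : Fact (x ∈ Icc a b) := ⟨hx⟩
    have hi : IntervalIntegrable φ volume a x :=
      (hφ.mono (by rw [uIcc_of_le hx.1]; exact Icc_subset_Icc_right hx.2)).intervalIntegrable
    exact ((intervalIntegral.integral_hasDerivWithinAt_right hi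
      (hφ.stronglyMeasurableAtFilter_nhdsWithin measurableSet_Icc x) (hφ x hx)).const_mul
      M).const_add D
  have key := le_gronwallBound_of_liminf_deriv_right_le (f := fun τ => D + M * ∫ s in a..τ, φ s)
    (f' := fun x => M * φ x) (δ := D) (K := M) (ε := 0)
    (fun x hx => (hF x hx).continuousWithinAt)
    (fun x hx r hr => by
      have := ((hF x (Ico_subset_Icc_self hx)).mono_of_mem_nhdsWithin (s := Ici x)
        (mem_of_superset (Icc_mem_nhdsGE hx.2) (Icc_subset_Icc_left hx.1))).liminf_right_slope_le hr
      simpa [slope_def_field, div_eq_inv_mul] using this)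
    (by simp)
    (fun x hx => by
      have := mul_le_mul_of_nonneg_left (h x (Ico_subset_Icc_self hx)) hM
      simpa using this) τ hτ
  rw [gronwallBound_ε0] at key
  exact (h τ hτ).trans key

end Gronwall

/-! ### Integral equations versus differential equations. -/

section Existence

/-- Continuity in time for each fixed point becomes continuity along a moving path because the
spatial Lipschitz constant is uniform in time. -/
theorem continuousOn_comp_of_lipschitz {E F : Type*} [NormedAddCommGroup E]
    [NormedAddCommGroup F] {f : ℝ → E → F} {K a b : ℝ} {γ : ℝ → E}
    (hf : ∀ x, ContinuousOn (fun t => f t x) (Icc a b))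
    (hK : ∀ t ∈ Icc a b, ∀ x y, ‖f t x - f t y‖ ≤ K * ‖x - y‖)
    (hγ : ContinuousOn γ (Icc a b)) : ContinuousOn (fun t => f t (γ t)) (Icc a b) := by
  intro s hs
  have h1 : Tendsto (fun t => f t (γ t) - f t (γ s)) (𝓝[Icc a b] s) (𝓝 0) := by
    rw [tendsto_zero_iff_norm_tendsto_zero]
    have h2 : Tendsto (fun t => K * ‖γ t - γ s‖) (𝓝[Icc a b] s) (𝓝 0) := by
      have : ContinuousWithinAt (fun t => K * ‖γ t - γ s‖) (Icc a b) s :=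
        ((((hγ s hs).sub continuousWithinAt_const)).norm).const_mul K
      simpa [ContinuousWithinAt] using this
    exact squeeze_zero' (Eventually.of_forall fun _ => norm_nonneg _)
      (eventually_of_mem self_mem_nhdsWithin fun t ht => hK t ht _ _) h2
  have h3 := h1.add (hf (γ s) s hs)
  simpa [ContinuousWithinAt] using h3

variable {E : Type*} [NormedAddCommGroup E] [NormedSpace ℝ E]

/-- A path with prescribed integral form satisfies the corresponding differential equation. -/
theorem hasDerivWithinAt_of_eq_integral [CompleteSpace E] {γ g : ℝ → E} {x : E} {a b : ℝ}
    (hg : ContinuousOn g (Icc a b)) (h : ∀ τ ∈ Icc a b, γ τ = x + ∫ s in a..τ, g s) :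
    ∀ τ ∈ Icc a b, HasDerivWithinAt γ (g τ) (Icc a b) τ := by
  intro τ hτ
  have : Fact (τ ∈ Icc a b) := ⟨hτ⟩
  have hi : IntervalIntegrable g volume a τ :=
    (hg.mono (by rw [uIcc_of_le hτ.1]; exact Icc_subset_Icc_right hτ.2)).intervalIntegrable
  exact ((intervalIntegral.integral_hasDerivWithinAt_right hi
    (hg.stronglyMeasurableAtFilter_nhdsWithin measurableSet_Icc τ) (hg τ hτ)).const_add
    x).congr h (h τ hτ)

theorem eq_integral_of_hasDerivWithinAt [CompleteSpace E] {γ g : ℝ → E} {a b : ℝ}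
    (hg : ContinuousOn g (Icc a b)) (h : ∀ τ ∈ Icc a b, HasDerivWithinAt γ (g τ) (Icc a b) τ) :
    ∀ τ ∈ Icc a b, γ τ = γ a + ∫ s in a..τ, g s := by
  intro τ hτ
  have hsub : Icc a τ ⊆ Icc a b := Icc_subset_Icc_right hτ.2
  rw [intervalIntegral.integral_eq_sub_of_hasDerivAt_of_le hτ.1
    (fun s hs => (h s (hsub hs)).continuousWithinAt.mono hsub)
    (fun s hs => (h s (hsub (Ioo_subset_Icc_self hs))).hasDerivAt
      (Icc_mem_nhds hs.1 (hs.2.trans_le hτ.2)))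
    ((hg.mono hsub).intervalIntegrable_of_Icc hτ.1)]
  abel

end Existence

/-! ### Global existence by a contraction in a weighted norm. -/

section Existence
variable {E : Type*} [NormedAddCommGroup E] [NormedSpace ℝ E]

/-- Global existence for `γ' = f_τ(γ) + g[γ]_τ` on `[a, b]`, where `f` is Lipschitz in space and the
nonlocal term `g` is Lipschitz in the uniform norm, with a small constant. -/
theorem exists_solution_of_lipschitz_add_nonlocal [CompleteSpace E] {f : ℝ → E → E}
    {g : (ℝ → E) → ℝ → E} {K ε a b : ℝ} (hab : a ≤ b) (hK0 : 0 ≤ K) (hε0 : 0 ≤ ε)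
    (hε : ε * Real.exp ((K + 1) * (b - a)) < 1)
    (hf : ∀ x, ContinuousOn (fun t => f t x) (Icc a b))
    (hK : ∀ t ∈ Icc a b, ∀ x y, ‖f t x - f t y‖ ≤ K * ‖x - y‖)
    (hg : ∀ γ, ContinuousOn γ (Icc a b) → ContinuousOn (g γ) (Icc a b))
    (hgL : ∀ γ η, ContinuousOn γ (Icc a b) → ContinuousOn η (Icc a b) → ∀ D,
      (∀ s ∈ Icc a b, ‖γ s - η s‖ ≤ D) → ∀ s ∈ Icc a b, ‖g γ s - g η s‖ ≤ ε * D) (x₀ : E) :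
    ∃ γ : ℝ → E, γ a = x₀ ∧
      ∀ τ ∈ Icc a b, HasDerivWithinAt γ (f τ (γ τ) + g γ τ) (Icc a b) τ := by
  -- The unknown is `y(s) = e^{-α(s-a)} γ(s)`, so the sup norm of `y` is an exponentially weighted
  -- norm of `γ`. The local term contracts by `K / α`; the nonlocal one sees all times, so it costs
  -- the largest weight and contributes `ε e^{α(b-a)} / α`. The sum is below one by `hε`, since `α -
  -- K = 1`.
  set α := K + 1 with hα
  have hα0 : 0 < α := by positivity
  let path : C(Icc a b, E) → ℝ → E := fun y s => Real.exp (α * (s - a)) • IccExtend hab y s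
  have hpath : ∀ y, Continuous (path y) := fun y => by
    have := y.continuous.Icc_extend' (h := hab)
    fun_prop
  let F : C(Icc a b, E) → ℝ → E := fun y s => f s (path y s) + g (path y) s
  have hF : ∀ y, ContinuousOn (F y) (Icc a b) := fun y =>
    (continuousOn_comp_of_lipschitz hf hK (hpath y).continuousOn).add (hg _ (hpath y).continuousOn)
  have hFi : ∀ y, ∀ τ ∈ Icc a b, IntervalIntegrable (F y) volume a τ := fun y τ hτ =>
    ((hF y).mono (by rw [uIcc_of_le hτ.1]; exact Icc_subset_Icc_right hτ.2)).intervalIntegrable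
  have hprim : ∀ y, ContinuousOn (fun τ => ∫ s in a..τ, F y s) (Icc a b) := fun y => by
    have := intervalIntegral.continuousOn_primitive_interval
      (((hF y).integrableOn_Icc).mono_set (by rw [uIcc_of_le hab]) : IntegrableOn (F y) (uIcc a b))
    rwa [uIcc_of_le hab] at this
  let T : C(Icc a b, E) → C(Icc a b, E) := fun y =>
    ⟨fun τ => Real.exp (-(α * (τ.1 - a))) • (x₀ + ∫ s in a..τ.1, F y s), by
      have h1 : Continuous fun τ : Icc a b => ∫ s in a..τ.1, F y s :=
        continuousOn_iff_continuous_domRestrict.1 (hprim y)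
      fun_prop⟩
  set c := (K + ε * Real.exp (α * (b - a))) / α with hc
  have hc0 : 0 ≤ c := by positivity
  have hc1 : c < 1 := by
    rw [hc, div_lt_one hα0]; linarith
  have hFL : ∀ y z, ∀ s ∈ Icc a b, ‖F y s - F z s‖ ≤
      c * (α * Real.exp (α * (s - a))) * dist y z := by
    intro y z s hs
    have hyz : ∀ u ∈ Icc a b, ‖path y u - path z u‖ ≤ Real.exp (α * (u - a)) * dist y z := by
      intro u hu
      simp only [path, ← smul_sub, norm_smul, Real.norm_eq_abs, Real.abs_exp,
        IccExtend_of_mem hab _ hu]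
      gcongr
      rw [← dist_eq_norm]
      exact ContinuousMap.dist_apply_le_dist _
    have h1 := (hK s hs (path y s) (path z s)).trans
      (mul_le_mul_of_nonneg_left (hyz s hs) hK0)
    have h2 := hgL (path y) (path z) (hpath y).continuousOn (hpath z).continuousOn
      (Real.exp (α * (b - a)) * dist y z) (fun u hu => (hyz u hu).trans (by
        gcongr; exact hu.2)) s hs
    have h3 : (1 : ℝ) ≤ Real.exp (α * (s - a)) :=
      Real.one_le_exp (mul_nonneg hα0.le (by linarith [hs.1]))
    calc ‖F y s - F z s‖ = ‖(f s (path y s) - f s (path z s)) +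
          (g (path y) s - g (path z) s)‖ := by simp only [F]; congr 1; abel
      _ ≤ K * (Real.exp (α * (s - a)) * dist y z) + ε * (Real.exp (α * (b - a)) * dist y z) :=
          (norm_add_le _ _).trans (add_le_add h1 h2)
      _ ≤ K * (Real.exp (α * (s - a)) * dist y z) +
          ε * (Real.exp (α * (b - a)) * dist y z) * Real.exp (α * (s - a)) := by
          exact add_le_add le_rfl (le_mul_of_one_le_right (by positivity) h3)
      _ = _ := by rw [hc]; field_simp
  have hT : ContractingWith ⟨c, hc0⟩ T := by
    refine ⟨by exact_mod_cast hc1, LipschitzWith.of_dist_le_mul fun y z => ?_⟩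
    rw [ContinuousMap.dist_le (by positivity)]
    intro τ
    have hτ := τ.2
    have hint : ∫ s in a..τ.1, c * (α * Real.exp (α * (s - a))) * dist y z =
        c * (Real.exp (α * (τ.1 - a)) - 1) * dist y z := by
      rw [intervalIntegral.integral_mul_const, intervalIntegral.integral_const_mul,
        intervalIntegral.integral_eq_sub_of_hasDerivAt (f := fun s => Real.exp (α * (s - a)))]
      · simp
      · intro s _
        have := (((hasDerivAt_id s).sub_const a).const_mul α).exp
        simpa [mul_comm] using this
      · exact (by fun_prop : Continuous fun s => α * Real.exp (α * (s - a))).intervalIntegrable _ _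
    have hb : ‖∫ s in a..τ.1, (F y s - F z s)‖ ≤
        c * (Real.exp (α * (τ.1 - a)) - 1) * dist y z := by
      rw [← hint]
      refine intervalIntegral.norm_integral_le_of_norm_le hτ.1 (Eventually.of_forall fun s hs =>
        hFL y z s ⟨hs.1.le, hs.2.trans hτ.2⟩) ?_
      exact (by fun_prop : Continuous fun s =>
        c * (α * Real.exp (α * (s - a))) * dist y z).intervalIntegrable _ _
    rw [dist_eq_norm]
    have heq : T y τ - T z τ = Real.exp (-(α * (τ.1 - a))) • ∫ s in a..τ.1, (F y s - F z s) := by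
      rw [intervalIntegral.integral_sub (hFi y _ hτ) (hFi z _ hτ)]
      simp only [T, ContinuousMap.coe_mk, ← smul_sub]
      congr 1; abel
    rw [heq, norm_smul, Real.norm_eq_abs, Real.abs_exp]
    calc Real.exp (-(α * (τ.1 - a))) * ‖∫ s in a..τ.1, (F y s - F z s)‖
        ≤ Real.exp (-(α * (τ.1 - a))) * (c * Real.exp (α * (τ.1 - a)) * dist y z) := by
          refine mul_le_mul_of_nonneg_left (hb.trans ?_) (Real.exp_pos _).le
          gcongr; linarith
      _ = c * dist y z := by
          rw [Real.exp_neg]; field_simp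
  obtain ⟨y, hy, -⟩ := hT.exists_fixedPoint (0 : C(Icc a b, E)) (edist_ne_top _ _)
  have hsol : ∀ τ ∈ Icc a b, path y τ = x₀ + ∫ s in a..τ, F y s := by
    intro τ hτ
    have h1 : y ⟨τ, hτ⟩ = Real.exp (-(α * (τ - a))) • (x₀ + ∫ s in a..τ, F y s) := by
      conv_lhs => rw [← hy.eq]
      rfl
    simp only [path, IccExtend_of_mem hab _ hτ, h1, smul_smul, ← Real.exp_add, add_neg_cancel,
      Real.exp_zero, one_smul]
  refine ⟨path y, by simpa using hsol a ⟨le_rfl, hab⟩, fun τ hτ => ?_⟩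
  exact hasDerivWithinAt_of_eq_integral (hF y) hsol τ hτ

/-- Global existence for an equation that is Lipschitz in space. -/
theorem exists_solution_of_lipschitz [CompleteSpace E] {f : ℝ → E → E}
    {K a b : ℝ} (hab : a ≤ b) (hK0 : 0 ≤ K)
    (hf : ∀ x, ContinuousOn (fun t => f t x) (Icc a b))
    (hK : ∀ t ∈ Icc a b, ∀ x y, ‖f t x - f t y‖ ≤ K * ‖x - y‖) (x₀ : E) :
    ∃ γ : ℝ → E, γ a = x₀ ∧ ∀ τ ∈ Icc a b, HasDerivWithinAt γ (f τ (γ τ)) (Icc a b) τ := by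
  simpa using exists_solution_of_lipschitz_add_nonlocal (g := fun _ _ => 0) (ε := 0) hab hK0 le_rfl
    (by simp) hf hK (fun _ _ => continuousOn_const) (by simp) x₀

/-- Global existence with a prescribed final value. -/
theorem exists_solution_of_lipschitz_backward [CompleteSpace E] {f : ℝ → E → E}
    {K a b : ℝ} (hab : a ≤ b) (hK0 : 0 ≤ K)
    (hf : ∀ x, ContinuousOn (fun t => f t x) (Icc a b))
    (hK : ∀ t ∈ Icc a b, ∀ x y, ‖f t x - f t y‖ ≤ K * ‖x - y‖) (x₀ : E) :
    ∃ γ : ℝ → E, γ b = x₀ ∧ ∀ τ ∈ Icc a b, HasDerivWithinAt γ (f τ (γ τ)) (Icc a b) τ := by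
  obtain ⟨γ, h0, hγ⟩ := exists_solution_of_lipschitz (f := fun s x => -f (a + b - s) x) hab hK0
    (fun x => ((hf x).comp (by fun_prop) fun s hs => reverse_mem_Icc hs).neg)
    (fun t ht x y => by
      rw [← neg_sub', norm_neg]
      exact hK _ (reverse_mem_Icc ht) x y) x₀
  refine ⟨fun s => γ (a + b - s), by simpa using h0, fun τ hτ => ?_⟩
  simpa using hasDerivWithinAt_comp_reverse (hγ _ (reverse_mem_Icc hτ))

end Existence

/-! ### Integration by parts for primitives of integrable functions. -/

section IntegrationByParts

/-- Controls are only square integrable, so trajectories need not be differentiable everywhere.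
Primitives of integrable functions are absolutely continuous with the expected derivative almost
everywhere, which suffices for the product rule. -/
theorem mul_sub_mul_eq_integral_of_primitives {f g f' g' : ℝ → ℝ} {a b : ℝ} (hab : a ≤ b)
    (hf' : IntervalIntegrable f' volume a b) (hg' : IntervalIntegrable g' volume a b)
    (hf : ∀ τ ∈ Icc a b, f τ = f a + ∫ s in a..τ, f' s)
    (hg : ∀ τ ∈ Icc a b, g τ = g a + ∫ s in a..τ, g' s) :
    f b * g b - f a * g a = ∫ s in a..b, (f' s * g s + f s * g' s) := by
  have hac : ∀ {h h' : ℝ → ℝ}, IntervalIntegrable h' volume a b →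
      AbsolutelyContinuousOnInterval (fun τ => h a + ∫ s in a..τ, h' s) a b := fun {h h'} hh => by
    refine AbsolutelyContinuousOnInterval.add ?_
      (hh.absolutelyContinuousOnInterval_intervalIntegral (by simp))
    exact (LipschitzWith.const (h a)).lipschitzOnWith.absolutelyContinuousOnInterval
  have hd : ∀ {h h' : ℝ → ℝ}, IntervalIntegrable h' volume a b →
      ∀ᵐ x, x ∈ uIcc a b → deriv (fun τ => h a + ∫ s in a..τ, h' s) x = h' x := fun {h h'} hh => by
    filter_upwards [hh.ae_hasDerivAt_integral] with x hx hxm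
    exact ((hx hxm a (by simp)).const_add (h a)).deriv
  have key := (hac (h := f) hf').integral_deriv_mul_eq_sub (hac (h := g) hg')
  rw [← hf b ⟨hab, le_rfl⟩, ← hg b ⟨hab, le_rfl⟩] at key
  simp only [intervalIntegral.integral_same, add_zero] at key
  rw [← key]
  apply intervalIntegral.integral_congr_ae
  filter_upwards [hd (h := f) hf', hd (h := g) hg'] with x h1 h2 hx
  have hx' : x ∈ uIcc a b := uIoc_subset_uIcc hx
  rw [h1 hx', h2 hx']
  rw [uIcc_of_le hab] at hx'
  rw [← hf x hx', ← hg x hx']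

/-- Integration by parts for the inner product of two vector-valued primitives. -/
theorem inner_sub_inner_eq_integral_of_primitives {d : ℕ} {f g f' g' : ℝ → State d} {a b : ℝ}
    (hab : a ≤ b)
    (hf' : IntervalIntegrable f' volume a b) (hg' : IntervalIntegrable g' volume a b)
    (hf : ∀ τ ∈ Icc a b, f τ = f a + ∫ s in a..τ, f' s)
    (hg : ∀ τ ∈ Icc a b, g τ = g a + ∫ s in a..τ, g' s) :
    inner ℝ (f b) (g b) - inner ℝ (f a) (g a) =
      ∫ s in a..b, (inner ℝ (f' s) (g s) + inner ℝ (f s) (g' s)) := by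
  have hint : ∀ {h' : ℝ → State d} (i : Fin d), IntervalIntegrable h' volume a b →
      IntervalIntegrable (fun s => h' s i) volume a b := fun {h'} i hh => by
    exact ⟨(EuclideanSpace.proj i : State d →L[ℝ] ℝ).integrable_comp hh.1,
      (EuclideanSpace.proj i : State d →L[ℝ] ℝ).integrable_comp hh.2⟩
  have hco : ∀ {h h' : ℝ → State d} (i : Fin d), IntervalIntegrable h' volume a b →
      (∀ τ ∈ Icc a b, h τ = h a + ∫ s in a..τ, h' s) →
      ∀ τ ∈ Icc a b, h τ i = h a i + ∫ s in a..τ, h' s i := fun {h h'} i hh hp τ hτ => by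
    have hsub : uIcc a τ ⊆ uIcc a b := by
      rw [uIcc_of_le hτ.1, uIcc_of_le hab]; exact Icc_subset_Icc_right hτ.2
    have : ∫ s in a..τ, h' s i = (∫ s in a..τ, h' s) i :=
      (EuclideanSpace.proj i : State d →L[ℝ] ℝ).intervalIntegral_comp_comm (hh.mono_set hsub)
    rw [this]
    conv_lhs => rw [hp τ hτ]
    simp
  have hcont : ∀ {h h' : ℝ → ℝ}, IntervalIntegrable h' volume a b →
      (∀ τ ∈ Icc a b, h τ = h a + ∫ s in a..τ, h' s) → ContinuousOn h (uIcc a b) :=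
    fun {h h'} hh hp => by
      have h1 := intervalIntegral.continuousOn_primitive_interval
        ((intervalIntegrable_iff' (by finiteness)).1 hh)
      refine (h1.const_add (h a)).congr fun τ hτ => hp τ (by rwa [uIcc_of_le hab] at hτ)
  simp only [PiLp.inner_apply, RCLike.inner_apply, conj_trivial]
  rw [← Finset.sum_sub_distrib]
  simp only [← Finset.sum_add_distrib]
  rw [intervalIntegral.integral_finsetSum]
  · refine Finset.sum_congr rfl fun i _ => ?_
    have := mul_sub_mul_eq_integral_of_primitives hab (hint i hg') (hint i hf') (hco i hg' hg)
      (hco i hf' hf)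
    rw [this]
    exact intervalIntegral.integral_congr fun s _ => by ring
  · intro i _
    exact ((hint i hf').continuousOn_mul (hcont (hint i hg') (hco i hg' hg))).add
      ((hint i hg').mul_continuousOn (hcont (hint i hf') (hco i hf' hf)))

end IntegrationByParts

/-! ### Taylor and continuity estimates for drift and reward. -/

section Regularity

theorem norm_sub_sub_fderiv_le {E F : Type*} [NormedAddCommGroup E] [NormedSpace ℝ E]
    [NormedAddCommGroup F] [NormedSpace ℝ F] {f : E → F} {K : ℝ} (hK : 0 ≤ K)
    (hf : Differentiable ℝ f)
    (hL : ∀ z z', ‖fderiv ℝ f z - fderiv ℝ f z'‖ ≤ K * ‖z - z'‖) (x y : E) :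
    ‖f y - f x - fderiv ℝ f x (y - x)‖ ≤ K * ‖y - x‖ ^ 2 := by
  have h := (convex_closedBall x ‖y - x‖).norm_image_sub_le_of_norm_fderiv_le'
    (f := f) (φ := fderiv ℝ f x) (C := K * ‖y - x‖) (fun z _ => hf z)
    (fun z hz => (hL z x).trans (mul_le_mul_of_nonneg_left (mem_closedBall_iff_norm.1 hz) hK))
    (Metric.mem_closedBall_self (norm_nonneg _)) (mem_closedBall_iff_norm.2 le_rfl)
  linarith [h]

namespace RegularityBounds

variable {d : ℕ} {b : ℝ → State d → State d} {r : State d → ℝ} {M K G L : ℝ}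

theorem drift_lipschitz (h : RegularityBounds b r M K G L) {s : ℝ} (hs : s ∈ Icc (0 : ℝ) 1)
    (x y : State d) : ‖b s x - b s y‖ ≤ M * ‖x - y‖ :=
  convex_univ.norm_image_sub_le_of_norm_fderiv_le (fun z _ => h.drift_differentiable s hs z)
    (fun z _ => h.drift_jacobian_bound s hs z) (mem_univ y) (mem_univ x)

theorem drift_taylor (h : RegularityBounds b r M K G L) {s : ℝ} (hs : s ∈ Icc (0 : ℝ) 1)
    (x y : State d) : ‖b s y - b s x - fderiv ℝ (b s) x (y - x)‖ ≤ K * ‖y - x‖ ^ 2 :=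
  norm_sub_sub_fderiv_le h.K_pos.le (h.drift_differentiable s hs) (h.drift_jacobian_lipschitz s hs)
    x y

theorem reward_taylor (h : RegularityBounds b r M K G L) (x y : State d) :
    |r y - r x - inner ℝ (gradient r x) (y - x)| ≤ L * ‖y - x‖ ^ 2 := by
  have := norm_sub_sub_fderiv_le h.L_pos.le h.reward_differentiable (fun z z' => by
    have := h.reward_gradient_lipschitz z z'
    rwa [gradient, gradient, ← map_sub, LinearIsometryEquiv.norm_map] at this) x y
  rwa [← inner_gradient_left, Real.norm_eq_abs] at this

theorem reward_lipschitz (h : RegularityBounds b r M K G L) (x y : State d) :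
    |r x - r y| ≤ G * ‖x - y‖ :=
  convex_univ.norm_image_sub_le_of_norm_fderiv_le (fun z _ => h.reward_differentiable z)
    (fun z _ => by
      have := h.reward_gradient_bound z
      rwa [gradient, LinearIsometryEquiv.norm_map] at this) (mem_univ y) (mem_univ x)

/-- The Jacobian is assumed Lipschitz in space only. Continuity in time is inherited from the
difference quotients of `b`: by the Taylor bound they converge uniformly in `s`. -/
theorem drift_jacobian_time_continuous (h : RegularityBounds b r M K G L) (x : State d) :
    ContinuousOn (fun s => fderiv ℝ (b s) x) (Icc 0 1) := by
  rw [continuousOn_clm_apply]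
  intro v
  have hlim : TendstoUniformlyOn (fun ρ s => ρ⁻¹ • (b s (x + ρ • v) - b s x))
      (fun s => fderiv ℝ (b s) x v) (𝓝[>] (0 : ℝ)) (Icc 0 1) := by
    rw [Metric.tendstoUniformlyOn_iff]
    intro ε hε
    have hsmall : ∀ᶠ ρ in 𝓝[>] (0 : ℝ), K * ‖v‖ ^ 2 * ρ < ε := by
      have : Tendsto (fun ρ : ℝ => K * ‖v‖ ^ 2 * ρ) (𝓝[>] 0) (𝓝 0) := by
        have : Continuous fun ρ : ℝ => K * ‖v‖ ^ 2 * ρ := by fun_prop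
        simpa using this.tendsto 0 |>.mono_left nhdsWithin_le_nhds
      exact this.eventually_lt_const hε
    filter_upwards [hsmall, self_mem_nhdsWithin] with ρ hρ hρ0 s hs
    have hρ0 : 0 < ρ := hρ0
    have ht := h.drift_taylor hs x (x + ρ • v)
    rw [add_sub_cancel_left, map_smul, norm_smul, Real.norm_eq_abs, abs_of_pos hρ0] at ht
    rw [dist_comm, dist_eq_norm]
    have heq : ρ⁻¹ • (b s (x + ρ • v) - b s x) - fderiv ℝ (b s) x v =
        ρ⁻¹ • (b s (x + ρ • v) - b s x - ρ • fderiv ℝ (b s) x v) := by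
      rw [smul_sub ρ⁻¹ _ (ρ • _), smul_smul, inv_mul_cancel₀ hρ0.ne', one_smul]
    rw [heq, norm_smul, norm_inv, Real.norm_eq_abs, abs_of_pos hρ0]
    calc ρ⁻¹ * ‖b s (x + ρ • v) - b s x - ρ • fderiv ℝ (b s) x v‖
        ≤ ρ⁻¹ * (K * (ρ * ‖v‖) ^ 2) := by gcongr
      _ = K * ‖v‖ ^ 2 * ρ := by field_simp
      _ < ε := hρ
  refine hlim.continuousOn (Eventually.frequently (Eventually.of_forall fun ρ => ?_))
  exact (((h.drift_time_continuous _).sub (h.drift_time_continuous _)).const_smul ρ⁻¹)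

theorem drift_comp_continuousOn (h : RegularityBounds b r M K G L) {t : ℝ} (ht : 0 ≤ t)
    {γ : ℝ → State d} (hγ : ContinuousOn γ (Icc t 1)) :
    ContinuousOn (fun s => b s (γ s)) (Icc t 1) :=
  continuousOn_comp_of_lipschitz
    (fun x => (h.drift_time_continuous x).mono (Icc_subset_Icc_left ht))
    (fun _ hs x y => h.drift_lipschitz (Icc_subset_Icc_left ht hs) x y) hγ

theorem adjoint_jacobian_comp_continuousOn (h : RegularityBounds b r M K G L) {t : ℝ}
    (ht : 0 ≤ t) {γ p : ℝ → State d} (hγ : ContinuousOn γ (Icc t 1))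
    (hp : ContinuousOn p (Icc t 1)) :
    ContinuousOn (fun s => ContinuousLinearMap.adjoint (fderiv ℝ (b s) (γ s)) (p s)) (Icc t 1) := by
  have h1 : ContinuousOn (fun s => fderiv ℝ (b s) (γ s)) (Icc t 1) :=
    continuousOn_comp_of_lipschitz (f := fun s x => fderiv ℝ (b s) x)
      (fun x => (h.drift_jacobian_time_continuous x).mono (Icc_subset_Icc_left ht))
      (fun s hs x y => h.drift_jacobian_lipschitz s (Icc_subset_Icc_left ht hs) x y) hγ
  exact ((LinearIsometryEquiv.continuous _).comp_continuousOn h1).clm_apply hp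

theorem norm_adjoint_jacobian_le (h : RegularityBounds b r M K G L) {s : ℝ}
    (hs : s ∈ Icc (0 : ℝ) 1) (x p : State d) :
    ‖ContinuousLinearMap.adjoint (fderiv ℝ (b s) x) p‖ ≤ M * ‖p‖ :=
  (ContinuousLinearMap.le_opNorm _ _).trans (by
    rw [LinearIsometryEquiv.norm_map]
    exact mul_le_mul_of_nonneg_right (h.drift_jacobian_bound s hs x) (norm_nonneg _))

theorem norm_adjoint_jacobian_sub_le (h : RegularityBounds b r M K G L) {s : ℝ}
    (hs : s ∈ Icc (0 : ℝ) 1) (x y p q : State d) :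
    ‖ContinuousLinearMap.adjoint (fderiv ℝ (b s) x) p -
      ContinuousLinearMap.adjoint (fderiv ℝ (b s) y) q‖ ≤
      M * ‖p - q‖ + K * ‖x - y‖ * ‖p‖ := by
  have h1 := h.norm_adjoint_jacobian_le hs y (p - q)
  have h2 : ‖ContinuousLinearMap.adjoint (fderiv ℝ (b s) x - fderiv ℝ (b s) y) p‖ ≤
      K * ‖x - y‖ * ‖p‖ :=
    (ContinuousLinearMap.le_opNorm _ _).trans (by
      rw [LinearIsometryEquiv.norm_map]
      exact mul_le_mul_of_nonneg_right (h.drift_jacobian_lipschitz s hs x y) (norm_nonneg _))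
  refine le_trans (le_of_eq ?_) ((norm_add_le _ _).trans (add_le_add h1 h2))
  rw [map_sub, map_sub, sub_apply]
  congr 1
  abel

end RegularityBounds

end Regularity

/-! ### The adjoint equation. -/

section Costate

/-- `p` solves the adjoint equation `p' = -∇b_τ(γ_τ)ᵀ p` along the path `γ` on `[t, 1]`. -/
def IsCostate {d : ℕ} (b : ℝ → State d → State d) (γ : ℝ → State d) (t : ℝ)
    (p : ℝ → State d) : Prop :=
  ∀ τ ∈ Icc t 1, HasDerivWithinAt p
    (-(ContinuousLinearMap.adjoint (fderiv ℝ (b τ) (γ τ)) (p τ))) (Icc t 1) τ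

variable {d : ℕ} {b : ℝ → State d → State d} {r : State d → ℝ} {M K G L : ℝ}

theorem IsCostate.continuousOn {γ p : ℝ → State d} {t : ℝ} (hp : IsCostate b γ t p) :
    ContinuousOn p (Icc t 1) := fun τ hτ => (hp τ hτ).continuousWithinAt

theorem IsCostate.restrict {γ p : ℝ → State d} {t t' : ℝ} (hp : IsCostate b γ t p) (h : t ≤ t') :
    IsCostate b γ t' p := fun τ hτ =>
  (hp τ (Icc_subset_Icc_left h hτ)).mono (Icc_subset_Icc_left h)

namespace RegularityBounds

/-- The adjoint equation is linear in `p` with rate at most `M`, so it can be solved backwards from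
any terminal value. -/
theorem exists_costate (h : RegularityBounds b r M K G L) {t : ℝ} (ht : t ∈ Icc (0 : ℝ) 1)
    {γ : ℝ → State d} (hγ : ContinuousOn γ (Icc t 1)) (w : State d) :
    ∃ p, p 1 = w ∧ IsCostate b γ t p :=
  exists_solution_of_lipschitz_backward (K := M)
    (f := fun s p => -(ContinuousLinearMap.adjoint (fderiv ℝ (b s) (γ s)) p)) ht.2 h.M_pos.le
    (fun _ => (h.adjoint_jacobian_comp_continuousOn ht.1 hγ continuousOn_const).neg)
    (fun s hs x y => by
      rw [← neg_sub', norm_neg, ← map_sub]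
      exact h.norm_adjoint_jacobian_le (Icc_subset_Icc_left ht.1 hs) _ _) w

theorem costate_bound (h : RegularityBounds b r M K G L) {t : ℝ} (ht : 0 ≤ t)
    {γ p : ℝ → State d} (hp : IsCostate b γ t p) :
    ∀ τ ∈ Icc t 1, ‖p τ‖ ≤ Real.exp (M * (1 - τ)) * ‖p 1‖ := by
  refine norm_le_supersolution_backward (M := M) (g := fun _ => 0) hp (by simp)
    (B' := fun τ => Real.exp (M * (1 - τ)) * (M * (-1)) * ‖p 1‖)
    (fun τ => ((((hasDerivAt_id τ).const_sub 1).const_mul M).exp).mul_const _)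
    (fun τ hτ => ?_) (fun τ _ => by linarith)
  rw [norm_neg, add_zero]
  exact h.norm_adjoint_jacobian_le (Icc_subset_Icc_left ht hτ) _ _

theorem costate_bound_exp (h : RegularityBounds b r M K G L) {t : ℝ} (ht : 0 ≤ t)
    {γ p : ℝ → State d} (hp : IsCostate b γ t p) :
    ∀ τ ∈ Icc t 1, ‖p τ‖ ≤ Real.exp M * ‖p 1‖ := fun τ hτ =>
  (h.costate_bound ht hp τ hτ).trans (by
    gcongr
    have := mul_nonneg h.M_pos.le (ht.trans hτ.1)
    linarith)

/-- Comparison of two costates with a supersolution `D` of the equation of their difference. -/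
theorem costate_sub_bound (h : RegularityBounds b r M K G L) {t : ℝ} (ht : 0 ≤ t)
    {γ η p q : ℝ → State d} (hp : IsCostate b γ t p) (hq : IsCostate b η t q)
    {β D D' : ℝ → ℝ} (hβ : ∀ τ ∈ Icc t 1, ‖γ τ - η τ‖ ≤ β τ) (h1 : ‖p 1 - q 1‖ ≤ D 1)
    (hD : ∀ τ, HasDerivAt D (D' τ) τ)
    (hD' : ∀ τ ∈ Icc t 1,
      M * D τ + K * β τ * (Real.exp (M * (1 - τ)) * ‖p 1‖) ≤ -D' τ) :
    ∀ τ ∈ Icc t 1, ‖p τ - q τ‖ ≤ D τ := by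
  refine norm_le_supersolution_backward (M := M)
    (g := fun τ => K * β τ * (Real.exp (M * (1 - τ)) * ‖p 1‖))
    (fun τ hτ => (hp τ hτ).sub (hq τ hτ)) h1 hD (fun τ hτ => ?_) hD'
  rw [neg_sub_neg, norm_sub_rev]
  refine (h.norm_adjoint_jacobian_sub_le (Icc_subset_Icc_left ht hτ) _ _ _ _).trans ?_
  have h2 := h.costate_bound ht hp τ hτ
  have h3 := hβ τ hτ
  have h4 := h.K_pos
  have h5 : 0 ≤ β τ := (norm_nonneg _).trans h3
  gcongr

end RegularityBounds

end Costate

/-! ### Stability of trajectories and expansion of the terminal reward. -/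

section Trajectories

variable {d : ℕ} {b : ℝ → State d → State d} {r : State d → ℝ} {M K G L : ℝ}

/-- A bound for the second-order remainder of the terminal reward, as a function of the initial
value and of the control. -/
noncomputable def remainderBound (M K G L : ℝ) : ℝ :=
  (L + Real.exp M * G * K) * Real.exp M ^ 2

namespace RegularityBounds

theorem isControlledTrajectory_of_hasDerivWithinAt (h : RegularityBounds b r M K G L) {t : ℝ}
    (ht : t ∈ Icc (0 : ℝ) 1) {u γ : ℝ → State d} (hu : ContinuousOn u (Icc t 1))
    (hγ : ∀ τ ∈ Icc t 1, HasDerivWithinAt γ (b τ (γ τ) + u τ) (Icc t 1) τ) :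
    IsControlledTrajectory b u t (γ t) γ := by
  have hc : ContinuousOn γ (Icc t 1) := fun τ hτ => (hγ τ hτ).continuousWithinAt
  have hg := (h.drift_comp_continuousOn ht.1 hc).add hu
  exact ⟨hc, hg.intervalIntegrable_of_Icc ht.2, eq_integral_of_hasDerivWithinAt hg hγ⟩

theorem hasDerivWithinAt_of_isControlledTrajectory (h : RegularityBounds b r M K G L) {t : ℝ}
    (ht : t ∈ Icc (0 : ℝ) 1) {x : State d} {u γ : ℝ → State d} (hu : ContinuousOn u (Icc t 1))
    (hγ : IsControlledTrajectory b u t x γ) :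
    ∀ τ ∈ Icc t 1, HasDerivWithinAt γ (b τ (γ τ) + u τ) (Icc t 1) τ :=
  hasDerivWithinAt_of_eq_integral ((h.drift_comp_continuousOn ht.1 hγ.continuousOn).add hu)
    hγ.eq_integral

theorem exists_trajectory (h : RegularityBounds b r M K G L) {t : ℝ}
    (ht : t ∈ Icc (0 : ℝ) 1) {u : ℝ → State d} (hu : ContinuousOn u (Icc t 1)) (x : State d) :
    ∃ γ, IsControlledTrajectory b u t x γ := by
  obtain ⟨γ, h0, hγ⟩ := exists_solution_of_lipschitz (f := fun s x => b s x + u s) ht.2 h.M_pos.le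
    (fun x => ((h.drift_time_continuous x).mono (Icc_subset_Icc_left ht.1)).add hu)
    (fun s hs x y => by
      rw [add_sub_add_right_eq_sub]
      exact h.drift_lipschitz (Icc_subset_Icc_left ht.1 hs) x y) x
  exact ⟨γ, h0 ▸ h.isControlledTrajectory_of_hasDerivWithinAt ht hu hγ⟩

theorem _root_.IsControlledTrajectory.initial {x : State d} {u γ : ℝ → State d} {t : ℝ}
    (ht : t ≤ 1) (hγ : IsControlledTrajectory b u t x γ) : γ t = x := by
  simpa using hγ.eq_integral t ⟨le_rfl, ht⟩

theorem trajectory_sub_eq_integral {t : ℝ} {x y : State d}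
    {u v γ η : ℝ → State d} (hγ : IsControlledTrajectory b u t x γ)
    (hη : IsControlledTrajectory b v t y η) :
    ∀ τ ∈ Icc t 1, η τ - γ τ = (y - x) + ∫ s in t..τ, (b s (η s) + v s - (b s (γ s) + u s)) := by
  intro τ hτ
  have hsub : uIcc t τ ⊆ uIcc t 1 := by
    rw [uIcc_of_le hτ.1, uIcc_of_le (hτ.1.trans hτ.2)]; exact Icc_subset_Icc_right hτ.2
  rw [hη.eq_integral τ hτ, hγ.eq_integral τ hτ, intervalIntegral.integral_sub
    (hη.integrable.mono_set hsub) (hγ.integrable.mono_set hsub)]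
  abel

/-- Stability of trajectories with respect to the initial value and the control. -/
theorem trajectory_sub_bound (h : RegularityBounds b r M K G L) {t : ℝ}
    (ht : t ∈ Icc (0 : ℝ) 1) {x y : State d} {u v γ η : ℝ → State d}
    (hu : IntervalIntegrable u volume t 1) (hv : IntervalIntegrable v volume t 1)
    (hγ : IsControlledTrajectory b u t x γ) (hη : IsControlledTrajectory b v t y η) :
    ∀ τ ∈ Icc t 1, ‖η τ - γ τ‖ ≤ (‖y - x‖ + ∫ s in t..1, ‖v s - u s‖) * Real.exp M := by
  intro τ hτ
  have hw : IntervalIntegrable (fun s => ‖v s - u s‖) volume t 1 := (hv.sub hu).norm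
  have hdc : ContinuousOn (fun s => ‖η s - γ s‖) (Icc t 1) :=
    (hη.continuousOn.sub hγ.continuousOn).norm
  have hD0 : 0 ≤ ∫ s in t..1, ‖v s - u s‖ :=
    intervalIntegral.integral_nonneg ht.2 fun _ _ => norm_nonneg _
  -- Grönwall is needed in integral form, as an `L²` control yields no pointwise derivative.
  have key := le_mul_exp_of_le_add_integral (φ := fun s => ‖η s - γ s‖)
    (D := ‖y - x‖ + ∫ s in t..1, ‖v s - u s‖) h.M_pos.le hdc (fun σ hσ => by
      have hsub : uIcc t σ ⊆ uIcc t 1 := by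
        rw [uIcc_of_le hσ.1, uIcc_of_le ht.2]; exact Icc_subset_Icc_right hσ.2
      have hdi : IntervalIntegrable (fun s => M * ‖η s - γ s‖) volume t σ :=
        ((hdc.mono (Icc_subset_Icc_right hσ.2)).const_mul M).intervalIntegrable_of_Icc hσ.1
      rw [trajectory_sub_eq_integral hγ hη σ hσ, add_assoc]
      refine (norm_add_le _ _).trans (add_le_add le_rfl ?_)
      calc ‖∫ s in t..σ, (b s (η s) + v s - (b s (γ s) + u s))‖
          ≤ ∫ s in t..σ, (‖v s - u s‖ + M * ‖η s - γ s‖) := by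
            refine intervalIntegral.norm_integral_le_of_norm_le hσ.1
              (Eventually.of_forall fun s hs => ?_) ((hw.mono_set hsub).add hdi)
            have := h.drift_lipschitz (s := s) ⟨ht.1.trans hs.1.le, hs.2.trans hσ.2⟩ (η s) (γ s)
            rw [add_sub_add_comm, add_comm (b s (η s) - b s (γ s))]
            exact (norm_add_le _ _).trans (add_le_add le_rfl this)
        _ = (∫ s in t..σ, ‖v s - u s‖) + M * ∫ s in t..σ, ‖η s - γ s‖ := by
            rw [intervalIntegral.integral_add (hw.mono_set hsub) hdi,
              intervalIntegral.integral_const_mul]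
        _ ≤ (∫ s in t..1, ‖v s - u s‖) + M * ∫ s in t..σ, ‖η s - γ s‖ := by
            gcongr
            exact intervalIntegral.integral_mono_interval le_rfl hσ.1 hσ.2
              (Eventually.of_forall fun _ => norm_nonneg _) hw) τ hτ
  refine key.trans ?_
  gcongr
  have := h.M_pos
  nlinarith [hτ.1, hτ.2, ht.1]

/-- First-order expansion of the end point of a trajectory, tested against a costate. -/
theorem costate_expansion (h : RegularityBounds b r M K G L) {t : ℝ}
    (ht : t ∈ Icc (0 : ℝ) 1) {x y : State d} {u v γ η p : ℝ → State d}
    (hu : IntervalIntegrable u volume t 1) (hv : IntervalIntegrable v volume t 1)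
    (hγ : IsControlledTrajectory b u t x γ) (hη : IsControlledTrajectory b v t y η)
    (hp : IsCostate b γ t p) :
    |inner ℝ (p 1) (η 1 - γ 1) - inner ℝ (p t) (y - x) - ∫ s in t..1, inner ℝ (p s) (v s - u s)| ≤
      Real.exp M * ‖p 1‖ * K * Real.exp M ^ 2 * (‖y - x‖ + ∫ s in t..1, ‖v s - u s‖) ^ 2 := by
  have hp'c : ContinuousOn (fun s => -(ContinuousLinearMap.adjoint (fderiv ℝ (b s) (γ s)) (p s)))
      (Icc t 1) := (h.adjoint_jacobian_comp_continuousOn ht.1 hγ.continuousOn hp.continuousOn).neg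
  have hδ := trajectory_sub_eq_integral hγ hη
  have hδt : η t - γ t = y - x := by rw [hγ.initial ht.2, hη.initial ht.2]
  -- The derivative of `⟨p, η - γ⟩` contains the linearized drift twice with opposite signs. What
  -- survives is the control difference plus `p` tested against the second-order Taylor remainder of
  -- `b`.
  have key := inner_sub_inner_eq_integral_of_primitives (f := p) (g := fun s => η s - γ s) ht.2
    (hp'c.intervalIntegrable_of_Icc ht.2) (hη.integrable.sub hγ.integrable)
    (eq_integral_of_hasDerivWithinAt hp'c hp) (fun τ hτ => by rw [hδt]; exact hδ τ hτ)
  simp only [hδt] at key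
  have hwi : IntervalIntegrable (fun s => inner ℝ (p s) (v s - u s)) volume t 1 := by
    have hpu : ContinuousOn p (uIcc t 1) := by rw [uIcc_of_le ht.2]; exact hp.continuousOn
    have h1 : IntervalIntegrable (fun s => ‖p s‖ * ‖v s - u s‖) volume t 1 :=
      (hv.sub hu).norm.continuousOn_mul hpu.norm
    refine h1.mono_fun ?_ (Eventually.of_forall fun s => ?_)
    · rw [uIoc_of_le ht.2]
      refine AEStronglyMeasurable.inner ?_ (hv.sub hu).1.aestronglyMeasurable
      exact (hp.continuousOn.aestronglyMeasurable measurableSet_Icc).mono_measure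
        (Measure.restrict_mono Ioc_subset_Icc_self le_rfl)
    · simpa using norm_inner_le_norm (𝕜 := ℝ) (p s) (v s - u s)
  have hRc : ContinuousOn (fun s => inner ℝ (p s) (b s (η s) - b s (γ s)) -
      inner ℝ (ContinuousLinearMap.adjoint (fderiv ℝ (b s) (γ s)) (p s)) (η s - γ s))
      (Icc t 1) :=
    (hp.continuousOn.inner ((h.drift_comp_continuousOn ht.1 hη.continuousOn).sub
      (h.drift_comp_continuousOn ht.1 hγ.continuousOn))).sub
      ((h.adjoint_jacobian_comp_continuousOn ht.1 hγ.continuousOn hp.continuousOn).inner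
        (hη.continuousOn.sub hγ.continuousOn))
  have hsplit : inner ℝ (p 1) (η 1 - γ 1) - inner ℝ (p t) (y - x) -
      ∫ s in t..1, inner ℝ (p s) (v s - u s) =
      ∫ s in t..1, (inner ℝ (p s) (b s (η s) - b s (γ s)) -
        inner ℝ (ContinuousLinearMap.adjoint (fderiv ℝ (b s) (γ s)) (p s)) (η s - γ s)) := by
    rw [key, sub_eq_iff_eq_add, ← intervalIntegral.integral_add
      (hRc.intervalIntegrable_of_Icc ht.2) hwi]
    refine intervalIntegral.integral_congr fun s _ => ?_
    simp only [inner_neg_left, add_sub_add_comm, inner_add_right]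
    ring
  rw [hsplit, ← Real.norm_eq_abs]
  set D := ‖y - x‖ + ∫ s in t..1, ‖v s - u s‖ with hD
  -- `D` controls the state difference up to the factor `e^M`, so the remainder is quadratic in `D`;
  -- as the interval has length at most one, integrating costs no further factor.
  have hbound := h.trajectory_sub_bound ht hu hv hγ hη
  have hlen : ∀ C : ℝ, 0 ≤ C → C * |1 - t| ≤ C := fun C hC => by
    refine mul_le_of_le_one_right hC ?_
    rw [abs_of_nonneg (by linarith [ht.2])]
    linarith [ht.1]
  refine (intervalIntegral.norm_integral_le_of_norm_le_const
    (C := Real.exp M * ‖p 1‖ * K * Real.exp M ^ 2 * D ^ 2) fun s hs => ?_).trans (hlen _ ?_)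
  · rw [uIoc_of_le ht.2] at hs
    have hs' : s ∈ Icc t 1 := Ioc_subset_Icc_self hs
    rw [ContinuousLinearMap.adjoint_inner_left, ← inner_sub_right]
    refine (norm_inner_le_norm _ _).trans ?_
    have h1 := h.costate_bound_exp ht.1 hp s hs'
    have h2 := h.drift_taylor (Icc_subset_Icc_left ht.1 hs') (γ s) (η s)
    have h3 := hbound s hs'
    have hK := h.K_pos
    calc _ ≤ (Real.exp M * ‖p 1‖) * (K * (D * Real.exp M) ^ 2) := by
          gcongr
          exact h2.trans (by gcongr)
      _ = _ := by ring
  · have hK := h.K_pos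
    positivity

/-- Second-order bound for the terminal reward. -/
theorem reward_expansion (h : RegularityBounds b r M K G L) {t : ℝ}
    (ht : t ∈ Icc (0 : ℝ) 1) {x y : State d} {u v γ η p : ℝ → State d}
    (hu : IntervalIntegrable u volume t 1) (hv : IntervalIntegrable v volume t 1)
    (hγ : IsControlledTrajectory b u t x γ) (hη : IsControlledTrajectory b v t y η)
    (hp : IsCostate b γ t p) (hp1 : p 1 = gradient r (γ 1)) :
    |r (η 1) - r (γ 1) - inner ℝ (p t) (y - x) - ∫ s in t..1, inner ℝ (p s) (v s - u s)| ≤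
      remainderBound M K G L * (‖y - x‖ + ∫ s in t..1, ‖v s - u s‖) ^ 2 := by
  have h1 := h.costate_expansion ht hu hv hγ hη hp
  have h2 := h.reward_taylor (γ 1) (η 1)
  have h3 := h.trajectory_sub_bound ht hu hv hγ hη 1 ⟨ht.2, le_rfl⟩
  have h4 := h.reward_gradient_bound (γ 1)
  rw [hp1] at h1
  set D := ‖y - x‖ + ∫ s in t..1, ‖v s - u s‖
  have h5 : L * ‖η 1 - γ 1‖ ^ 2 ≤ L * (D * Real.exp M) ^ 2 := by
    have := h.L_pos
    gcongr
  have h6 : Real.exp M * ‖gradient r (γ 1)‖ * K * Real.exp M ^ 2 * D ^ 2 ≤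
      Real.exp M * G * K * Real.exp M ^ 2 * D ^ 2 := by
    have := h.K_pos
    gcongr
  have h7 : remainderBound M K G L * D ^ 2 =
      L * (D * Real.exp M) ^ 2 + Real.exp M * G * K * Real.exp M ^ 2 * D ^ 2 := by
    rw [remainderBound]; ring
  rw [h7]
  rw [abs_le] at h1 h2 ⊢
  constructor <;> linarith [h1.1, h1.2, h2.1, h2.2]

end RegularityBounds

end Trajectories

/-! ### Differentiability of the flow map and the greedy guidance. -/

section Flow

variable {d : ℕ} {b : ℝ → State d → State d} {r : State d → ℝ} {M K G L : ℝ}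

theorem hasFDerivAt_of_norm_sub_sub_le {E F : Type*} [NormedAddCommGroup E] [NormedSpace ℝ E]
    [NormedAddCommGroup F] [NormedSpace ℝ F] {f : E → F} {f' : E →L[ℝ] F} {x : E} {C : ℝ}
    (h : ∀ y, ‖f y - f x - f' (y - x)‖ ≤ C * ‖y - x‖ ^ 2) : HasFDerivAt f f' x := by
  rw [hasFDerivAt_iff_isLittleO]
  refine (Asymptotics.IsBigO.of_bound C (Eventually.of_forall fun y => ?_)).trans_isLittleO
    (Asymptotics.isLittleO_pow_sub_sub x (by norm_num : 1 < 2))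
  simpa using h y

namespace RegularityBounds

theorem flowMap_spec (h : RegularityBounds b r M K G L) {t : ℝ} (ht : t ∈ Icc (0 : ℝ) 1)
    (x : State d) :
    ∃ γ, IsControlledTrajectory b (fun _ => 0) t x γ ∧ γ 1 = flowMap b t 1 x := by
  have hex := h.exists_trajectory ht (u := fun _ => 0) continuousOn_const x
  refine ⟨hex.choose, hex.choose_spec, ?_⟩
  rw [flowMap, dif_pos hex]

/-- A costate that ends at the `i`-th basis vector represents the differential of the `i`-th
coordinate of the flow; `costate_expansion` supplies the quadratic remainder. -/
theorem differentiableAt_flowMap (h : RegularityBounds b r M K G L) {t : ℝ}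
    (ht : t ∈ Icc (0 : ℝ) 1) (x : State d) : DifferentiableAt ℝ (flowMap b t 1) x := by
  rw [differentiableAt_euclidean]
  intro i
  obtain ⟨γ, hγ, hγ1⟩ := h.flowMap_spec ht x
  obtain ⟨p, hp1, hp⟩ := h.exists_costate ht hγ.continuousOn (EuclideanSpace.single i (1 : ℝ))
  refine (hasFDerivAt_of_norm_sub_sub_le (f' := innerSL ℝ (p t))
    (C := Real.exp M * ‖p 1‖ * K * Real.exp M ^ 2) fun y => ?_).differentiableAt
  obtain ⟨η, hη, hη1⟩ := h.flowMap_spec ht y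
  have := h.costate_expansion ht intervalIntegrable_const intervalIntegrable_const hγ hη hp
  simp only [sub_self, inner_zero_right, intervalIntegral.integral_zero, sub_zero, norm_zero,
    add_zero] at this
  rw [hγ1, hη1] at this
  have hi : inner ℝ (p 1) (flowMap b t 1 y - flowMap b t 1 x) =
      flowMap b t 1 y i - flowMap b t 1 x i := by
    rw [hp1, EuclideanSpace.inner_single_left]; simp
  rw [hi] at this
  exact this

/-- The costate along an uncontrolled trajectory is the gradient of the terminal reward. -/
theorem adjoint_fderiv_flowMap (h : RegularityBounds b r M K G L) {t : ℝ}
    (ht : t ∈ Icc (0 : ℝ) 1) {x : State d} {γ p : ℝ → State d}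
    (hγ : IsControlledTrajectory b (fun _ => 0) t x γ) (hγ1 : γ 1 = flowMap b t 1 x)
    (hp : IsCostate b γ t p) (hp1 : p 1 = gradient r (γ 1)) :
    ContinuousLinearMap.adjoint (fderiv ℝ (flowMap b t 1) x) (gradient r (flowMap b t 1 x)) =
      p t := by
  have h1 : HasFDerivAt (fun y => r (flowMap b t 1 y)) (innerSL ℝ (p t)) x := by
    refine hasFDerivAt_of_norm_sub_sub_le (C := remainderBound M K G L) fun y => ?_
    obtain ⟨η, hη, hη1⟩ := h.flowMap_spec ht y
    have := h.reward_expansion ht intervalIntegrable_const intervalIntegrable_const hγ hη hp hp1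
    simp only [sub_self, inner_zero_right, intervalIntegral.integral_zero, sub_zero, norm_zero,
      add_zero] at this
    rw [hγ1, hη1] at this
    exact this
  have h2 := (h.reward_differentiable (flowMap b t 1 x)).hasFDerivAt.comp x
    (h.differentiableAt_flowMap ht x).hasFDerivAt
  have h3 := h1.unique h2
  refine ext_inner_right ℝ fun v => ?_
  rw [ContinuousLinearMap.adjoint_inner_left, inner_gradient_left]
  exact (DFunLike.congr_fun h3 v).symm

theorem hasGradientAt_reward_flowMap (h : RegularityBounds b r M K G L) {t : ℝ}
    (ht : t ∈ Icc (0 : ℝ) 1) (x : State d) :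
    HasGradientAt (fun y => r (flowMap b t 1 y))
      (ContinuousLinearMap.adjoint (fderiv ℝ (flowMap b t 1) x)
        (gradient r (flowMap b t 1 x))) x := by
  have h2 := (h.reward_differentiable (flowMap b t 1 x)).hasFDerivAt.comp x
    (h.differentiableAt_flowMap ht x).hasFDerivAt
  rw [hasGradientAt_iff_hasFDerivAt]
  refine h2.congr_fderiv (ContinuousLinearMap.ext fun v => ?_)
  rw [InnerProductSpace.toDual_apply_apply, ContinuousLinearMap.adjoint_inner_left,
    inner_gradient_left]
  rfl

end RegularityBounds

end Flow

/-! ### Pontryagin extremals, their existence and optimality. -/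

section Extremals

variable {d : ℕ} {b : ℝ → State d → State d} {r : State d → ℝ} {M K G L : ℝ}

/-- `(γ, p)` solves the Hamiltonian system of the control problem on `[t, 1]`. -/
structure IsExtremal {d : ℕ} (b : ℝ → State d → State d) (r : State d → ℝ) (lam t : ℝ)
    (γ p : ℝ → State d) : Prop where
  state : ∀ τ ∈ Icc t 1, HasDerivWithinAt γ (b τ (γ τ) + lam • p τ) (Icc t 1) τ
  costate : IsCostate b γ t p
  transversality : p 1 = gradient r (γ 1)

theorem IsExtremal.restrict {lam t t' : ℝ} {γ p : ℝ → State d} (h : IsExtremal b r lam t γ p)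
    (ht : t ≤ t') : IsExtremal b r lam t' γ p :=
  ⟨fun τ hτ => (h.state τ (Icc_subset_Icc_left ht hτ)).mono (Icc_subset_Icc_left ht),
    h.costate.restrict ht, h.transversality⟩

theorem memLp_two_of_continuousOn_Icc {u : ℝ → State d} {t : ℝ} (hu : ContinuousOn u (Icc t 1)) :
    MemLp u 2 (volume.restrict (Icc t 1)) := by
  obtain ⟨C, hC⟩ := isCompact_Icc.exists_bound_of_continuousOn hu
  exact MemLp.of_bound (hu.aestronglyMeasurable measurableSet_Icc) C
    ((ae_restrict_iff' measurableSet_Icc).2 (Eventually.of_forall hC))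

theorem intervalIntegrable_of_memLp_two {u : ℝ → State d} {t : ℝ} (ht : t ≤ 1)
    (hu : MemLp u 2 (volume.restrict (Icc t 1))) : IntervalIntegrable u volume t 1 := by
  rw [intervalIntegrable_iff_integrableOn_Icc_of_le ht (by finiteness)]
  exact hu.integrable (by norm_num)

theorem intervalIntegrable_norm_sq_of_memLp_two {u : ℝ → State d} {t : ℝ} (ht : t ≤ 1)
    (hu : MemLp u 2 (volume.restrict (Icc t 1))) :
    IntervalIntegrable (fun s => ‖u s‖ ^ 2) volume t 1 := by
  rw [intervalIntegrable_iff_integrableOn_Icc_of_le ht (by finiteness)]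
  exact hu.integrable_norm_pow (by norm_num)

/-- Jensen's inequality on an interval of length at most one. -/
theorem sq_integral_norm_le {w : ℝ → State d} {t : ℝ} (ht : t ∈ Icc (0 : ℝ) 1)
    (hw : MemLp w 2 (volume.restrict (Icc t 1))) :
    (∫ s in t..1, ‖w s‖) ^ 2 ≤ ∫ s in t..1, ‖w s‖ ^ 2 := by
  have h1 := (intervalIntegrable_of_memLp_two ht.2 hw).norm
  have h2 := intervalIntegrable_norm_sq_of_memLp_two ht.2 hw
  set m := ∫ s in t..1, ‖w s‖ with hm
  -- Integrating `(‖w‖ - m)²` gives `Q - 2m² + (1 - t)m² ≥ 0`, with `Q` the integral of `‖w‖²`;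
  -- hence `Q ≥ (1 + t)m² ≥ m²`.
  have h3 : 0 ≤ ∫ s in t..1, (‖w s‖ ^ 2 - 2 * m * ‖w s‖ + m ^ 2) :=
    intervalIntegral.integral_nonneg ht.2 fun s _ => by nlinarith [sq_nonneg (‖w s‖ - m)]
  rw [intervalIntegral.integral_add (h2.sub (h1.const_mul _)) intervalIntegrable_const,
    intervalIntegral.integral_sub h2 (h1.const_mul _), intervalIntegral.integral_const_mul,
    intervalIntegral.integral_const, ← hm, smul_eq_mul] at h3
  nlinarith [ht.1, sq_nonneg m, mul_nonneg ht.1 (sq_nonneg m)]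

namespace RegularityBounds

/-- This makes the terminal-value costate a Lipschitz functional of the whole path in the uniform
norm, the input for the fixed-point argument. The barrier collects the discrepancy `L D` at time one
and the source `K D G` along the way. -/
theorem costate_lipschitz (h : RegularityBounds b r M K G L) {t : ℝ} (ht : 0 ≤ t) (ht1 : t ≤ 1)
    {γ η p q : ℝ → State d} (hp : IsCostate b γ t p) (hq : IsCostate b η t q)
    (hp1 : p 1 = gradient r (γ 1)) (hq1 : q 1 = gradient r (η 1)) {D : ℝ}
    (hD : ∀ τ ∈ Icc t 1, ‖γ τ - η τ‖ ≤ D) :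
    ∀ τ ∈ Icc t 1, ‖p τ - q τ‖ ≤ (L + K * G) * Real.exp M * D := by
  have hK := h.K_pos
  have hL := h.L_pos
  have hM := h.M_pos
  have hG := h.G_pos
  have hD1 := hD 1 ⟨ht1, le_rfl⟩
  have hD0 : 0 ≤ D := (norm_nonneg _).trans hD1
  have key := h.costate_sub_bound ht hp hq (β := fun _ => D)
    (D := fun τ => D * (L + K * G * (1 - τ)) * Real.exp (M * (1 - τ)))
    (D' := fun τ => D * (K * G * (-1)) * Real.exp (M * (1 - τ)) +
      D * (L + K * G * (1 - τ)) * (Real.exp (M * (1 - τ)) * (M * (-1)))) hD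
    (by
      rw [hp1, hq1]
      have := (h.reward_gradient_lipschitz (γ 1) (η 1)).trans
        (mul_le_mul_of_nonneg_left hD1 hL.le)
      simpa [mul_comm] using this)
    (fun τ => by
      have h1 := ((((hasDerivAt_id τ).const_sub 1).const_mul (K * G)).const_add L).const_mul D
      exact h1.mul ((((hasDerivAt_id τ).const_sub 1).const_mul M).exp))
    (fun τ hτ => by
      have h1 : ‖p 1‖ ≤ G := hp1 ▸ h.reward_gradient_bound _
      have h2 : K * D * (Real.exp (M * (1 - τ)) * ‖p 1‖) ≤
        K * D * (Real.exp (M * (1 - τ)) * G) := by gcongr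
      linarith)
  intro τ hτ
  have h01 : 0 ≤ 1 - τ := by linarith [hτ.2]
  calc _ ≤ D * (L + K * G * (1 - τ)) * Real.exp (M * (1 - τ)) := key τ hτ
    _ ≤ D * (L + K * G * 1) * Real.exp (M * 1) := by
        gcongr <;> linarith [hτ.1]
    _ = _ := by rw [mul_one, mul_one]; ring

/-- The two-point boundary problem is turned into a forward equation by regarding the costate `P γ`
as a nonlocal function of the path. Its Lipschitz constant carries the factor `lam`, so smallness of
`lam` gives a contraction. -/
theorem exists_extremal (h : RegularityBounds b r M K G L) {lam t : ℝ}
    (ht : t ∈ Icc (0 : ℝ) 1) (hlam : 0 < lam)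
    (hsmall : lam * ((L + K * G) * Real.exp M) * Real.exp (M + 1) < 1) (x : State d) :
    ∃ γ p, γ t = x ∧ IsExtremal b r lam t γ p := by
  have hK := h.K_pos
  have hL := h.L_pos
  have hM := h.M_pos
  have hG := h.G_pos
  choose! P hP1 hP using fun (γ : ℝ → State d) (hγ : ContinuousOn γ (Icc t 1)) =>
    h.exists_costate ht hγ (gradient r (γ 1))
  obtain ⟨γ, h0, hγ⟩ := exists_solution_of_lipschitz_add_nonlocal (f := b)
    (g := fun γ τ => lam • P γ τ) (ε := lam * ((L + K * G) * Real.exp M)) ht.2 hM.le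
    (by positivity)
    (lt_of_le_of_lt (by
      gcongr
      have : (M + 1) * (1 - t) ≤ (M + 1) * 1 := by
        gcongr
        linarith [ht.1]
      linarith) hsmall)
    (fun x => (h.drift_time_continuous x).mono (Icc_subset_Icc_left ht.1))
    (fun s hs x y => h.drift_lipschitz (Icc_subset_Icc_left ht.1 hs) x y)
    (fun γ hγ => (hP γ hγ).continuousOn.const_smul lam)
    (fun γ η hγ hη D hD s hs => by
      rw [← smul_sub, norm_smul, Real.norm_eq_abs, abs_of_pos hlam, mul_assoc]
      exact mul_le_mul_of_nonneg_left (h.costate_lipschitz ht.1 ht.2 (hP γ hγ) (hP η hη)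
        (hP1 γ hγ) (hP1 η hη) hD s hs) hlam.le) x
  have hc : ContinuousOn γ (Icc t 1) := fun τ hτ => (hγ τ hτ).continuousWithinAt
  exact ⟨γ, P γ, h0, hγ, hP γ hc, hP1 γ hc⟩

theorem remainderBound_pos (h : RegularityBounds b r M K G L) : 0 < remainderBound M K G L := by
  have hK := h.K_pos
  have hL := h.L_pos
  have hG := h.G_pos
  unfold remainderBound
  positivity

theorem extremal_isAdmissible (h : RegularityBounds b r M K G L) {lam t : ℝ}
    (ht : t ∈ Icc (0 : ℝ) 1) {γ p : ℝ → State d} (he : IsExtremal b r lam t γ p) :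
    IsAdmissible b t (γ t) (fun s => lam • p s) γ := by
  have hu : ContinuousOn (fun s => lam • p s) (Icc t 1) := he.costate.continuousOn.const_smul lam
  exact ⟨memLp_two_of_continuousOn_Icc hu,
    h.isControlledTrajectory_of_hasDerivWithinAt ht hu he.state⟩

/-- Quantitative optimality of extremals, with respect to the control and to the initial value. -/
theorem extremal_cost_le (h : RegularityBounds b r M K G L) {lam t : ℝ}
    (ht : t ∈ Icc (0 : ℝ) 1) (hlam : 0 < lam) (hsmall : 4 * remainderBound M K G L * lam ≤ 1)
    {γ p v η : ℝ → State d} (he : IsExtremal b r lam t γ p) {y : State d}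
    (hη : IsAdmissible b t y v η) :
    controlCost r lam t (fun s => lam • p s) γ - inner ℝ (p t) (y - γ t) -
      2 * remainderBound M K G L * ‖y - γ t‖ ^ 2 ≤ controlCost r lam t v η := by
  have hγ := h.extremal_isAdmissible ht he
  set R := remainderBound M K G L with hR
  have hR0 : 0 < R := h.remainderBound_pos
  have hui := intervalIntegrable_of_memLp_two ht.2 hγ.1
  have hvi := intervalIntegrable_of_memLp_two ht.2 hη.1
  have hu2 := intervalIntegrable_norm_sq_of_memLp_two ht.2 hγ.1
  have hv2 := intervalIntegrable_norm_sq_of_memLp_two ht.2 hη.1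
  have hw : MemLp (fun s => v s - lam • p s) 2 (volume.restrict (Icc t 1)) := hη.1.sub hγ.1
  have hw2 := intervalIntegrable_norm_sq_of_memLp_two ht.2 hw
  have hexp := h.reward_expansion ht hui hvi hγ.2 hη.2 he.costate he.transversality
  rw [← hR] at hexp
  have hJ := sq_integral_norm_le ht hw
  -- Since the control is `lam • p`, the first-order term is exactly the difference of the running
  -- costs minus a square. That square is the convexity gain.
  have hpt : ∀ s, inner ℝ (p s) (v s - lam • p s) = 1 / (2 * lam) * ‖v s‖ ^ 2 -
      1 / (2 * lam) * ‖lam • p s‖ ^ 2 - 1 / (2 * lam) * ‖v s - lam • p s‖ ^ 2 := by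
    intro s
    have h1 := norm_add_sq_real (lam • p s) (v s - lam • p s)
    rw [add_sub_cancel, real_inner_smul_left] at h1
    rw [h1]
    field_simp
    ring
  have hint : ∫ s in t..1, inner ℝ (p s) (v s - lam • p s) =
      (∫ s in t..1, 1 / (2 * lam) * ‖v s‖ ^ 2) - (∫ s in t..1, 1 / (2 * lam) * ‖lam • p s‖ ^ 2) -
        1 / (2 * lam) * ∫ s in t..1, ‖v s - lam • p s‖ ^ 2 := by
    simp only [hpt]
    rw [intervalIntegral.integral_sub ((hv2.const_mul _).sub (hu2.const_mul _)) (hw2.const_mul _),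
      intervalIntegral.integral_sub (hv2.const_mul _) (hu2.const_mul _),
      intervalIntegral.integral_const_mul (1 / (2 * lam)) fun s => ‖v s - lam • p s‖ ^ 2]
  rw [hint] at hexp
  set m := ∫ s in t..1, ‖v s - lam • p s‖
  set Q := ∫ s in t..1, ‖v s - lam • p s‖ ^ 2
  have h1 : R * (‖y - γ t‖ + m) ^ 2 ≤ 2 * R * ‖y - γ t‖ ^ 2 + 2 * R * Q := by
    have : (‖y - γ t‖ + m) ^ 2 ≤ 2 * ‖y - γ t‖ ^ 2 + 2 * Q := by
      nlinarith [sq_nonneg (‖y - γ t‖ - m)]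
    nlinarith
  -- The convexity gain absorbs the control part of the remainder; this is the condition `4 R lam ≤
  -- 1`.
  have h2 : 2 * R * Q ≤ 1 / (2 * lam) * Q := by
    have hQ : 0 ≤ Q := (sq_nonneg m).trans hJ
    refine mul_le_mul_of_nonneg_right ?_ hQ
    rw [le_div_iff₀ (by positivity)]
    linarith
  unfold controlCost
  linarith [(abs_le.1 hexp).2]

/-- The smallness condition on `lam` under which extremals exist and are optimal. -/
def IsSmallParameter (M K G L lam : ℝ) : Prop :=
  0 < lam ∧ lam * ((L + K * G) * Real.exp M) * Real.exp (M + 1) < 1 ∧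
    4 * remainderBound M K G L * lam ≤ 1

theorem extremal_minimizes (h : RegularityBounds b r M K G L) {lam t : ℝ}
    (ht : t ∈ Icc (0 : ℝ) 1) (hlam : IsSmallParameter M K G L lam)
    {γ p v η : ℝ → State d} (he : IsExtremal b r lam t γ p)
    (hη : IsAdmissible b t (γ t) v η) :
    controlCost r lam t (fun s => lam • p s) γ ≤ controlCost r lam t v η := by
  simpa using h.extremal_cost_le ht hlam.1 hlam.2.2 he hη

theorem valueFunction_eq (h : RegularityBounds b r M K G L) {lam t : ℝ}
    (ht : t ∈ Icc (0 : ℝ) 1) (hlam : IsSmallParameter M K G L lam)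
    {γ p : ℝ → State d} (he : IsExtremal b r lam t γ p) :
    valueFunction b r lam t (γ t) = controlCost r lam t (fun s => lam • p s) γ := by
  refine IsLeast.csInf_eq ⟨⟨_, _, h.extremal_isAdmissible ht he, rfl⟩, ?_⟩
  rintro c ⟨v, η, hη, rfl⟩
  exact h.extremal_minimizes ht hlam he hη

theorem valueFunction_le (h : RegularityBounds b r M K G L) {lam t : ℝ}
    (ht : t ∈ Icc (0 : ℝ) 1) (hlam : IsSmallParameter M K G L lam) {y : State d}
    {v η : ℝ → State d} (hη : IsAdmissible b t y v η) :
    valueFunction b r lam t y ≤ controlCost r lam t v η := by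
  obtain ⟨γ, p, rfl, he⟩ := h.exists_extremal ht hlam.1 hlam.2.1 y
  rw [h.valueFunction_eq ht hlam he]
  exact h.extremal_minimizes ht hlam he hη

/-- The gradient of the value function is minus the costate of the extremal. -/
theorem hasGradientAt_valueFunction (h : RegularityBounds b r M K G L) {lam t : ℝ}
    (ht : t ∈ Icc (0 : ℝ) 1) (hlam : IsSmallParameter M K G L lam)
    {γ p : ℝ → State d} (he : IsExtremal b r lam t γ p) :
    HasGradientAt (valueFunction b r lam t) (-p t) (γ t) := by
  rw [hasGradientAt_iff_hasFDerivAt]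
  have hR0 := h.remainderBound_pos
  refine hasFDerivAt_of_norm_sub_sub_le (C := 2 * remainderBound M K G L) fun y => ?_
  rw [InnerProductSpace.toDual_apply_apply, inner_neg_left, h.valueFunction_eq ht hlam he,
    Real.norm_eq_abs, abs_le]
  have hadm := h.extremal_isAdmissible ht he
  constructor
  -- Lower bound: the optimal pair from `y` is a competitor in `extremal_cost_le`.
  · obtain ⟨η, q, rfl, hη⟩ := h.exists_extremal ht hlam.1 hlam.2.1 y
    rw [h.valueFunction_eq ht hlam hη]
    linarith [h.extremal_cost_le ht hlam.1 hlam.2.2 he (h.extremal_isAdmissible ht hη)]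
  -- Upper bound: the open-loop control of `γ` is reused from `y`, so the running costs cancel and
  -- only the rewards are compared.
  · obtain ⟨η, hη⟩ := h.exists_trajectory ht (he.costate.continuousOn.const_smul lam) y
    have hle := h.valueFunction_le ht hlam (⟨hadm.1, hη⟩ : IsAdmissible b t y _ η)
    have hui := intervalIntegrable_of_memLp_two ht.2 hadm.1
    have hexp := h.reward_expansion ht hui hui hadm.2 hη he.costate he.transversality
    simp only [sub_self, inner_zero_right, intervalIntegral.integral_zero, sub_zero, norm_zero,
      add_zero] at hexp
    have h1 : 0 ≤ remainderBound M K G L * ‖y - γ t‖ ^ 2 := by positivity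
    unfold controlCost at hle ⊢
    linarith [(abs_le.1 hexp).1]

/-- A tail of an extremal is again an extremal, so the gradient formula holds at every later point
of the path. The closed loop therefore reproduces the extremal. -/
theorem optimalFeedback_extremal (h : RegularityBounds b r M K G L) {lam t : ℝ}
    (ht : t ∈ Icc (0 : ℝ) 1) (hlam : IsSmallParameter M K G L lam)
    {γ p : ℝ → State d} (he : IsExtremal b r lam t γ p) :
    ∀ τ ∈ Icc t 1, optimalFeedback b r lam τ (γ τ) = lam • p τ := fun τ hτ => by
  rw [optimalFeedback, (h.hasGradientAt_valueFunction (Icc_subset_Icc_left ht.1 hτ) hlam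
    (he.restrict hτ.1)).gradient, smul_neg, neg_neg]

theorem isOptimalFeedbackLaw (h : RegularityBounds b r M K G L) {lam : ℝ}
    (hlam : IsSmallParameter M K G L lam) :
    IsOptimalFeedbackLaw b r lam (optimalFeedback b r lam) := by
  intro t ht x
  obtain ⟨γ, p, rfl, he⟩ := h.exists_extremal ht hlam.1 hlam.2.1 x
  have hf := h.optimalFeedback_extremal ht hlam he
  have hc : ContinuousOn (fun τ => optimalFeedback b r lam τ (γ τ)) (Icc t 1) :=
    (he.costate.continuousOn.const_smul lam).congr hf
  refine ⟨γ, ⟨memLp_two_of_continuousOn_Icc hc,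
    h.isControlledTrajectory_of_hasDerivWithinAt ht hc fun τ hτ => ?_⟩, fun v η hη => ?_⟩
  · rw [hf τ hτ]
    exact he.state τ hτ
  · refine le_trans (le_of_eq ?_) (h.extremal_minimizes ht hlam he hη)
    unfold controlCost
    congr 1
    refine intervalIntegral.integral_congr fun τ hτ => ?_
    rw [uIcc_of_le ht.2] at hτ
    simp only [hf τ hτ]

end RegularityBounds

end Extremals

/-! ### Comparison of the two costates and the constant `C₁`. -/

section FeedbackEstimate

variable {d : ℕ} {b : ℝ → State d → State d} {r : State d → ℝ} {M K G L : ℝ}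

/-- The product `e^{Mτ} e^{M(1-τ)} = e^M` makes the integrand an elementary derivative. The closed
form is what the Grönwall estimate produces at `t = 0`. -/
theorem feedbackConstant_eq (hM : M ≠ 0) (K G L : ℝ) :
    feedbackConstant M K G L = G * Real.exp M *
      (L * (Real.exp M ^ 2 - 1) / (2 * M) + K * G * (Real.exp M - 1) ^ 2 / (2 * M ^ 2)) := by
  have hderiv : ∀ τ ∈ uIcc (0 : ℝ) 1, HasDerivAt
      (fun τ => -(G * Real.exp M * (K * G / M * (Real.exp (2 * M * (1 - τ)) / (2 * M) -
        Real.exp (M * (1 - τ)) / M) + L * (Real.exp (2 * M * (1 - τ)) / (2 * M)))))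
      (jacobianBound M τ * (hessianBound M K (1 - τ) * G + jacobianBound M (1 - τ) ^ 2 * L) *
        (jacobianBound M (1 - τ) * G)) τ := by
    intro τ _
    have h1 : HasDerivAt (fun τ => Real.exp (M * (1 - τ)))
        (Real.exp (M * (1 - τ)) * (M * (-1))) τ :=
      (((hasDerivAt_id τ).const_sub 1).const_mul M).exp
    have h2 : HasDerivAt (fun τ => Real.exp (2 * M * (1 - τ)))
        (Real.exp (2 * M * (1 - τ)) * (2 * M * (-1))) τ :=
      (((hasDerivAt_id τ).const_sub 1).const_mul (2 * M)).exp
    refine (((((h2.div_const (2 * M)).sub (h1.div_const M)).const_mul (K * G / M)).add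
      ((h2.div_const (2 * M)).const_mul L)).const_mul (G * Real.exp M)).neg.congr_deriv ?_
    unfold jacobianBound hessianBound
    have e1 : Real.exp (M * τ) * Real.exp (M * (1 - τ)) = Real.exp M := by
      rw [← Real.exp_add]; congr 1; ring
    have e2 : Real.exp (2 * M * (1 - τ)) = Real.exp (M * (1 - τ)) ^ 2 := by
      rw [← Real.exp_nat_mul]; congr 1; push_cast; ring
    rw [e2, ← e1]
    field_simp
    ring
  rw [feedbackConstant, intervalIntegral.integral_eq_sub_of_hasDerivAt hderiv]
  · have e2 : Real.exp (2 * M) = Real.exp M ^ 2 := by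
      rw [← Real.exp_nat_mul]; congr 1
    simp only [sub_self, mul_zero, Real.exp_zero, sub_zero, mul_one, e2]
    field_simp
    ring
  · unfold jacobianBound hessianBound
    exact Continuous.intervalIntegrable (by fun_prop) _ _

namespace RegularityBounds

/-- Distance between an extremal and the uncontrolled trajectory with the same initial value. -/
theorem extremal_sub_uncontrolled_bound (h : RegularityBounds b r M K G L) {lam t : ℝ}
    (ht : t ∈ Icc (0 : ℝ) 1) (hlam : 0 < lam) {γ p η : ℝ → State d}
    (he : IsExtremal b r lam t γ p) (hη : IsControlledTrajectory b (fun _ => 0) t (γ t) η) :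
    ∀ τ ∈ Icc t 1, ‖γ τ - η τ‖ ≤
      lam * G / (2 * M) * (Real.exp (M * (1 + τ - 2 * t)) - Real.exp (M * (1 - τ))) := by
  have hM := h.M_pos
  -- The barrier is the exact solution of `B' = M B + lam G e^{M(1-τ)}` with `B(t) = 0`; the source
  -- bounds `‖lam • p τ‖`.
  refine norm_le_supersolution (M := M) (g := fun τ => lam * (Real.exp (M * (1 - τ)) * G))
    (B' := fun τ => lam * G / (2 * M) * (Real.exp (M * (1 + τ - 2 * t)) * (M * 1) -
      Real.exp (M * (1 - τ)) * (M * (-1))))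
    (fun τ hτ => (he.state τ hτ).sub
      (h.hasDerivWithinAt_of_isControlledTrajectory ht continuousOn_const hη τ hτ)) ?_ ?_ ?_ ?_
  · rw [hη.initial ht.2, sub_self, norm_zero]
    have : 1 + t - 2 * t = 1 - t := by ring
    rw [this, sub_self, mul_zero]
  · intro τ
    exact ((((((hasDerivAt_id τ).const_add 1).sub_const (2 * t)).const_mul M).exp).sub
      ((((hasDerivAt_id τ).const_sub 1).const_mul M).exp)).const_mul _
  · intro τ hτ
    have h1 := h.drift_lipschitz (Icc_subset_Icc_left ht.1 hτ) (γ τ) (η τ)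
    have h2 := h.costate_bound ht.1 he.costate τ hτ
    have h3 : ‖p 1‖ ≤ G := he.transversality ▸ h.reward_gradient_bound _
    rw [add_zero, add_sub_right_comm]
    refine (norm_add_le _ _).trans (add_le_add h1 ?_)
    rw [norm_smul, Real.norm_eq_abs, abs_of_pos hlam]
    gcongr
    exact h2.trans (by gcongr)
  · intro τ _
    refine le_of_eq ?_
    field_simp
    ring

/-- The costates of the controlled and of the uncontrolled problem differ by a term of order
`lam`. -/
theorem extremal_costate_sub_bound (h : RegularityBounds b r M K G L) {lam t : ℝ}
    (ht : t ∈ Icc (0 : ℝ) 1) (hlam : 0 < lam) {γ p η q : ℝ → State d}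
    (he : IsExtremal b r lam t γ p) (hη : IsControlledTrajectory b (fun _ => 0) t (γ t) η)
    (hq : IsCostate b η t q) (hq1 : q 1 = gradient r (η 1)) :
    ‖p t - q t‖ ≤ feedbackConstant M K G L * lam := by
  have hM := h.M_pos
  have hK := h.K_pos
  have hL := h.L_pos
  have hG := h.G_pos
  have hβ := h.extremal_sub_uncontrolled_bound ht hlam he hη
  have hp1 : ‖p 1‖ ≤ G := he.transversality ▸ h.reward_gradient_bound _
  set B : ℝ → ℝ := fun τ =>
    lam * G / (2 * M) * (Real.exp (M * (1 + τ - 2 * t)) - Real.exp (M * (1 - τ))) with hB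
  -- `D` solves `-D' = M D + K G e^{M(1-τ)} B` backwards from `D(1) = L B(1)`: the bracket
  -- multiplying `e^{M(1-τ)}` has derivative `-K G B`, and its `K G` part vanishes at time one.
  have key := h.costate_sub_bound ht.1 he.costate hq (β := B)
    (D := fun τ => Real.exp (M * (1 - τ)) * (L * B 1 + K * G * (lam * G / (2 * M ^ 2) *
      (Real.exp (M * (1 + 1 - 2 * t)) - Real.exp (M * (1 + τ - 2 * t)) - Real.exp (M * (1 - τ)) +
        1))))
    (D' := fun τ => Real.exp (M * (1 - τ)) * (M * (-1)) * (L * B 1 + K * G *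
      (lam * G / (2 * M ^ 2) * (Real.exp (M * (1 + 1 - 2 * t)) - Real.exp (M * (1 + τ - 2 * t)) -
        Real.exp (M * (1 - τ)) + 1))) + Real.exp (M * (1 - τ)) * (K * G * (lam * G / (2 * M ^ 2) *
          (-(Real.exp (M * (1 + τ - 2 * t)) * (M * 1)) - Real.exp (M * (1 - τ)) * (M * (-1))))))
    hβ
    (by
      rw [he.transversality, hq1]
      have := (h.reward_gradient_lipschitz (γ 1) (η 1)).trans
        (mul_le_mul_of_nonneg_left (hβ 1 ⟨ht.2, le_rfl⟩) hL.le)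
      simpa [hB] using this)
    (fun τ => by
      have h1 : HasDerivAt (fun τ => Real.exp (M * (1 - τ)))
          (Real.exp (M * (1 - τ)) * (M * (-1))) τ :=
        (((hasDerivAt_id τ).const_sub 1).const_mul M).exp
      have h2 : HasDerivAt (fun τ => Real.exp (M * (1 + τ - 2 * t)))
          (Real.exp (M * (1 + τ - 2 * t)) * (M * 1)) τ :=
        ((((hasDerivAt_id τ).const_add 1).sub_const (2 * t)).const_mul M).exp
      exact h1.mul ((((((h2.const_sub _).sub h1).add_const 1).const_mul _).const_mul
        (K * G)).const_add (L * B 1)))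
    (fun τ hτ => by
      have hB0 : 0 ≤ B τ := (norm_nonneg _).trans (hβ τ hτ)
      have h2 : K * B τ * (Real.exp (M * (1 - τ)) * ‖p 1‖) ≤
        K * B τ * (Real.exp (M * (1 - τ)) * G) := by gcongr
      have h3 : lam * G / (2 * M ^ 2) *
          (-(Real.exp (M * (1 + τ - 2 * t)) * (M * 1)) - Real.exp (M * (1 - τ)) * (M * (-1))) =
          -B τ := by
        simp only [hB]; field_simp; ring
      rw [h3]
      linarith) t ⟨le_rfl, ht.2⟩
  refine key.trans ?_
  have e1 : 1 + t - 2 * t = 1 - t := by ring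
  have e2 : Real.exp (M * (1 + 1 - 2 * t)) = Real.exp (M * (1 - t)) ^ 2 := by
    rw [← Real.exp_nat_mul]; congr 1; push_cast; ring
  have e3 : M * (1 - t) ≤ M := by nlinarith [ht.1]
  have e4 : 1 ≤ Real.exp (M * (1 - t)) := Real.one_le_exp (mul_nonneg hM.le (by linarith [ht.2]))
  have e5 : Real.exp (M * (1 - t)) ≤ Real.exp M := Real.exp_le_exp.2 e3
  simp only [hB, e1, e2, sub_self, mul_zero, Real.exp_zero]
  rw [feedbackConstant_eq hM.ne']
  -- The bound at time `t` depends on `t` only through `z`, with `1 ≤ z ≤ e^M`, and is increasing in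
  -- `z`. Replacing `z` by `e^M` gives `C₁`.
  generalize Real.exp (M * (1 - t)) = z at *
  calc z * (L * (lam * G / (2 * M) * (z ^ 2 - 1)) +
        K * G * (lam * G / (2 * M ^ 2) * (z ^ 2 - z - z + 1)))
      = G * z * (L * (z ^ 2 - 1) / (2 * M) + K * G * (z - 1) ^ 2 / (2 * M ^ 2)) * lam := by
        field_simp
        ring
    _ ≤ _ := by
        have : 0 ≤ z - 1 := by linarith
        have : 0 ≤ z ^ 2 - 1 := by nlinarith
        gcongr

theorem optimalFeedback_sub_greedyGuidance_le (h : RegularityBounds b r M K G L) {lam t : ℝ}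
    (ht : t ∈ Icc (0 : ℝ) 1) (hlam : IsSmallParameter M K G L lam) (x : State d) :
    ‖optimalFeedback b r lam t x - greedyGuidance b r lam t x‖ ≤
      feedbackConstant M K G L * lam ^ 2 := by
  obtain ⟨γ, p, rfl, he⟩ := h.exists_extremal ht hlam.1 hlam.2.1 x
  obtain ⟨η, hη, hη1⟩ := h.flowMap_spec ht (γ t)
  obtain ⟨q, hq1, hq⟩ := h.exists_costate ht hη.continuousOn (gradient r (η 1))
  rw [h.optimalFeedback_extremal ht hlam he t ⟨le_rfl, ht.2⟩, greedyGuidance,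
    h.adjoint_fderiv_flowMap ht hη hη1 hq hq1, ← smul_sub, norm_smul, Real.norm_eq_abs,
    abs_of_pos hlam.1]
  have := mul_le_mul_of_nonneg_left (h.extremal_costate_sub_bound ht hlam.1 he hη hq hq1) hlam.1.le
  linarith

end RegularityBounds

end FeedbackEstimate

/-! ### The zeroth-order term of the expansion. -/

section ZerothOrder

variable {d : ℕ} {b : ℝ → State d → State d} {r : State d → ℝ} {M K G L : ℝ}

namespace RegularityBounds

/-- The zero control gives the upper bound. For the lower bound, a control of `L¹` norm `m` raises
the reward by at most `G e^M m` and costs at least `m² / (2 lam)`; Young's inequality leaves a gain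
of order `lam`. -/
theorem abs_valueFunction_add_reward_flowMap_le (h : RegularityBounds b r M K G L) {lam t : ℝ}
    (ht : t ∈ Icc (0 : ℝ) 1) (hlam : 0 < lam) (x : State d) :
    |valueFunction b r lam t x + r (flowMap b t 1 x)| ≤ (G * Real.exp M) ^ 2 * lam := by
  have hG := h.G_pos
  obtain ⟨γ, hγ, hγ1⟩ := h.flowMap_spec ht x
  have h0 : IsAdmissible b t x (fun _ => 0) γ :=
    ⟨memLp_two_of_continuousOn_Icc continuousOn_const, hγ⟩
  have hcost : controlCost r lam t (fun _ => 0) γ = -r (flowMap b t 1 x) := by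
    simp [controlCost, hγ1]
  have hlow : ∀ c ∈ {c : ℝ | ∃ u γ : ℝ → State d, IsAdmissible b t x u γ ∧
      c = controlCost r lam t u γ}, -r (flowMap b t 1 x) - (G * Real.exp M) ^ 2 * lam ≤ c := by
    rintro c ⟨v, η, hη, rfl⟩
    have hvi := intervalIntegrable_of_memLp_two ht.2 hη.1
    have hv2 := intervalIntegrable_norm_sq_of_memLp_two ht.2 hη.1
    have h1 := h.trajectory_sub_bound ht intervalIntegrable_const hvi hγ hη.2 1 ⟨ht.2, le_rfl⟩
    have h2 := h.reward_lipschitz (η 1) (γ 1)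
    have h3 := sq_integral_norm_le ht hη.1
    simp only [sub_self, norm_zero, zero_add, sub_zero] at h1
    rw [controlCost, intervalIntegral.integral_const_mul]
    rw [hγ1] at h1 h2
    set m := ∫ s in t..1, ‖v s‖
    set Q := ∫ s in t..1, ‖v s‖ ^ 2
    have h4 : r (η 1) - r (flowMap b t 1 x) ≤ G * Real.exp M * m := by
      have := mul_le_mul_of_nonneg_left h1 hG.le
      linarith [(abs_le.1 h2).2]
    have h5 : G * Real.exp M * m ≤ 1 / (2 * lam) * m ^ 2 + (G * Real.exp M) ^ 2 * lam := by
      have h6 : 0 ≤ (m - lam * (G * Real.exp M)) ^ 2 / (2 * lam) := by positivity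
      have h7 : (m - lam * (G * Real.exp M)) ^ 2 / (2 * lam) =
          1 / (2 * lam) * m ^ 2 - G * Real.exp M * m + (G * Real.exp M) ^ 2 * lam / 2 := by
        field_simp
        ring
      have h8 : 0 ≤ (G * Real.exp M) ^ 2 * lam := by positivity
      linarith
    have h6 : 1 / (2 * lam) * m ^ 2 ≤ 1 / (2 * lam) * Q := by gcongr
    linarith
  have hmem : -r (flowMap b t 1 x) ∈ {c : ℝ | ∃ u γ : ℝ → State d, IsAdmissible b t x u γ ∧
      c = controlCost r lam t u γ} := ⟨_, _, h0, hcost.symm⟩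
  have h1 : valueFunction b r lam t x ≤ -r (flowMap b t 1 x) := csInf_le ⟨_, hlow⟩ hmem
  have h2 : _ ≤ valueFunction b r lam t x := le_csInf ⟨_, hmem⟩ hlow
  have h8 : 0 ≤ (G * Real.exp M) ^ 2 * lam := by positivity
  rw [abs_le]
  constructor <;> linarith

theorem zerothOrder_eq (h : RegularityBounds b r M K G L) {V0 V1 : ℝ → State d → ℝ}
    (hexp : HasUniformExpansion b r V0 V1) {t : ℝ} (ht : t ∈ Icc (0 : ℝ) 1) (x : State d) :
    V0 t x = -r (flowMap b t 1 x) := by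
  obtain ⟨C, lam₀, hlam₀, hC⟩ := hexp t ht
  have hlim : Tendsto (fun lam : ℝ => C * lam ^ 2 + lam * |V1 t x| + (G * Real.exp M) ^ 2 * lam)
      (𝓝[>] 0) (𝓝 0) := by
    have : Continuous fun lam : ℝ =>
      C * lam ^ 2 + lam * |V1 t x| + (G * Real.exp M) ^ 2 * lam := by fun_prop
    simpa using this.tendsto 0 |>.mono_left nhdsWithin_le_nhds
  have hle : |V0 t x + r (flowMap b t 1 x)| ≤ 0 := by
    refine ge_of_tendsto hlim ?_
    filter_upwards [Ioo_mem_nhdsGT hlam₀] with lam hlam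
    have h1 := hC lam hlam x
    have h2 := h.abs_valueFunction_add_reward_flowMap_le ht hlam.1 x
    have h3 : |lam * V1 t x| = lam * |V1 t x| := by rw [abs_mul, abs_of_pos hlam.1]
    rw [← h3]
    rw [abs_le] at h1 h2 ⊢
    constructor <;> linarith [le_abs_self (lam * V1 t x), neg_abs_le (lam * V1 t x), h1.1, h1.2]
  have := abs_nonpos_iff.1 hle
  linarith

theorem exists_isSmallParameter (h : RegularityBounds b r M K G L) :
    ∃ lam₀ > 0, ∀ lam ∈ Ioo (0 : ℝ) lam₀, IsSmallParameter M K G L lam := by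
  have hK := h.K_pos
  have hL := h.L_pos
  have hG := h.G_pos
  have hR := h.remainderBound_pos
  set c := (L + K * G) * Real.exp M * Real.exp (M + 1) with hc
  have hc0 : 0 < c := by positivity
  refine ⟨min (1 / c) (1 / (4 * remainderBound M K G L)), by positivity, fun lam hlam => ?_⟩
  have h1 := hlam.2.trans_le (min_le_left _ _)
  have h2 := hlam.2.trans_le (min_le_right _ _)
  rw [lt_div_iff₀ (by positivity)] at h1 h2
  exact ⟨hlam.1, by rw [mul_assoc]; exact h1, by linarith⟩

end RegularityBounds

end ZerothOrder

/-! ### Conclusion. -/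

theorem mainTheorem2 {d : ℕ} (b : ℝ → State d → State d) (r : State d → ℝ) (M K G L : ℝ)
    (hreg : RegularityBounds b r M K G L)
    (V0 V1 : ℝ → State d → ℝ) (hexp : HasUniformExpansion b r V0 V1) :
    (∀ t ∈ Set.Icc (0 : ℝ) 1, ∀ x : State d,
      V0 t x = -r (flowMap b t 1 x) ∧
      DifferentiableAt ℝ (flowMap b t 1) x ∧
      DifferentiableAt ℝ (V0 t) x ∧
      ∀ lam : ℝ, 0 < lam → greedyGuidance b r lam t x = -(lam • gradient (V0 t) x)) ∧
    (∃ C₂ : ℝ, ∃ lam₀ > 0, ∀ lam ∈ Set.Ioo (0 : ℝ) lam₀,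
      IsOptimalFeedbackLaw b r lam (optimalFeedback b r lam) ∧
      ∀ t ∈ Set.Icc (0 : ℝ) 1, ∀ x : State d,
        DifferentiableAt ℝ (valueFunction b r lam t) x ∧
        ‖optimalFeedback b r lam t x - greedyGuidance b r lam t x‖ ≤
          feedbackConstant M K G L * lam ^ 2 + C₂ * lam ^ 3) := by
  constructor
  · intro t ht x
    have hV0 : V0 t = -fun y => r (flowMap b t 1 y) :=
      funext fun y => hreg.zerothOrder_eq hexp ht y
    have hgrad : HasGradientAt (V0 t) (-ContinuousLinearMap.adjoint (fderiv ℝ (flowMap b t 1) x)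
        (gradient r (flowMap b t 1 x))) x := by
      have h1 := (hreg.hasGradientAt_reward_flowMap ht x).hasFDerivAt.neg
      rw [hV0, hasGradientAt_iff_hasFDerivAt, map_neg]
      exact h1
    refine ⟨hreg.zerothOrder_eq hexp ht x, hreg.differentiableAt_flowMap ht x,
      hgrad.differentiableAt, fun lam _ => ?_⟩
    rw [hgrad.gradient, smul_neg, neg_neg, greedyGuidance]
  · obtain ⟨lam₀, hlam₀, hsmall⟩ := hreg.exists_isSmallParameter
    -- The quadratic estimate is already exact in `lam`, so `C₂ = 0` suffices.
    refine ⟨0, lam₀, hlam₀, fun lam hlam => ⟨hreg.isOptimalFeedbackLaw (hsmall lam hlam),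
      fun t ht x => ⟨?_, ?_⟩⟩⟩
    · obtain ⟨γ, p, rfl, he⟩ := hreg.exists_extremal ht hlam.1 (hsmall lam hlam).2.1 x
      exact (hreg.hasGradientAt_valueFunction ht (hsmall lam hlam) he).differentiableAt
    · rw [zero_mul, add_zero]
      exact hreg.optimalFeedback_sub_greedyGuidance_le ht (hsmall lam hlam) x
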